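/- Let $A$ be a complex Banach algebra (possibly non-unital, with $\|ab\|\le\|a\|\|b\|$) with a bounded (conjugate-linear, anti-multiplicative) involution, let $G$ be a locally compact Hausdorff group with left Haar measure $ds$ and modular function $\Delta$ (normalised by $\Delta(r)\int_G f(sr)\,ds=\int_G f(s)\,ds$), and let $\alpha$ be a strongly continuous action of $G$ on $A$ by bounded involutive automorphisms. Assume that for each $\varepsilon>0$ the algebra $A$ has a $(1+\varepsilon)$-bounded approximate left identity, i.e. a net $(u_i)$ in $A$ with $\|u_i\|\le 1+\varepsilon$ and $u_ia\to a$ for all $a\in A$. Let $\mathcal H$ be a class of complex Hilbert spaces, and let $\mathcal R$ consist of all pairs $(\pi,U)$ where, for some $H\in\mathcal H$, $\pi:A\to B(H)$ is a contractive involutive homomorphism that is non-degenerate (the span of $\{\pi(a)x : a\in A,\,x\in H\}$ is dense in $H$), $U$ is a strongly continuous unitary representation of $G$ on $H$, and $\pi(\alpha_s(a))=U_s\pi(a)U_s^{-1}$ for all $a\in A$, $s\in G$. Assume that $\mathcal R$ is non-empty. Equip the space $C_c(G,A)$ of compactly supported continuous functions with the product $[f*g](s)=\int_G f(r)\,\alpha_r(g(r^{-1}s))\,dr$,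 the involution $f^*(s)=\Delta(s^{-1})\,\alpha_s(f(s^{-1})^*)$ and the seminorm $\sigma^{\mathcal R}(f)=\sup_{(\pi,U)\in\mathcal R}\|(\pi\rtimes U)(f)\|$, where $(\pi\rtimes U)(f)x=\int_G\pi(f(s))U_sx\,ds$. Let $(A\rtimes_\alpha G)^{\mathcal R}$ be the completion of $C_c(G,A)/\ker\sigma^{\mathcal R}$ in the norm induced by $\sigma^{\mathcal R}$, with the induced product and involution, let $q^{\mathcal R}:C_c(G,A)\to(A\rtimes_\alpha G)^{\mathcal R}$ be the canonical map, and for $(\pi,U)\in\mathcal R$ on $H$ let $(\pi\rtimes U)^{\mathcal R}:(A\rtimes_\alpha G)^{\mathcal R}\to B(H)$ be the continuous homomorphism determined by $(\pi\rtimes U)^{\mathcal R}(q^{\mathcal R}(f))=(\pi\rtimes U)(f)$. Then $(A\rtimes_\alpha G)^{\mathcal R}$ is a $C^*$-algebra, and $(\pi,U)\mapsto(\pi\rtimes U)^{\mathcal R}$ is a bijection between $\mathcal R$ and the non-degenerate involutive representations of $(A\rtimes_\alpha G)^{\mathcal R}$ in spaces from $\mathcal H$. This map preserves the set of closed invariant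 subspaces: a closed subspace is invariant under all $\pi(a)$ and all $U_s$ if and only if it is invariant under all $(\pi\rtimes U)^{\mathcal R}(c)$, $c \in (A\rtimes_\alpha G)^{\mathcal R}$. It also preserves the bounded intertwining operators between any two elements $(\pi,U)$ (on $H$) and $(\pi',U')$ (on $H'$) of $\mathcal R$: a bounded operator $\Phi:H\to H'$ satisfies $\pi'(a)\Phi=\Phi\pi(a)$ and $U'_s\Phi=\Phi U_s$ for all $a\in A$, $s\in G$ if and only if $(\pi'\rtimes U')^{\mathcal R}(c)\Phi=\Phi(\pi\rtimes U)^{\mathcal R}(c)$ for all $c\in(A\rtimes_\alpha G)^{\mathcal R}$. -/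

import Mathlib

open MeasureTheory Filter Topology
open scoped NNReal CompactlySupported Pointwise

universe u w v

set_option linter.unusedSectionVars false

noncomputable section

namespace BanachCrossed

section Haar

variable {G : Type w} [Group G] [TopologicalSpace G] [IsTopologicalGroup G]
  [LocallyCompactSpace G]

/-- The modular function `Δ`, normalised by `Δ(r) ∫ f(sr) ds = ∫ f(s) ds` for left Haar
measure; Mathlib's `modularCharacter` is normalised the other way round. -/
def modularFn (s : G) : ℝ := ((Measure.modularCharacter (s⁻¹) : ℝ≥0) : ℝ)

lemma modularFn_mul (s t : G) : modularFn (s * t) = modularFn s * modularFn t := by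
  simp [modularFn, mul_comm]

lemma modularFn_one : modularFn (1 : G) = 1 := by simp [modularFn]

lemma modularFn_inv_mul (s : G) : modularFn s⁻¹ * modularFn s = 1 := by
  rw [← modularFn_mul, inv_mul_cancel, modularFn_one]

variable [MeasurableSpace G] [BorelSpace G] (μ : Measure G) [μ.IsHaarMeasure]
variable {E : Type*} [NormedAddCommGroup E] [NormedSpace ℝ E] [CompleteSpace E]

lemma modularFn_mul_integral (f : G → ℝ) (hf : Continuous f) (hc : HasCompactSupport f)
    (r : G) : modularFn r * ∫ s, f (s * r) ∂μ = ∫ s, f s ∂μ := by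
  have h := Measure.integral_isMulLeftInvariant_eq_smul_of_hasCompactSupport
    (μ.map (· * r)) μ hf hc
  rw [integral_map (AEMeasurable.mul_const aemeasurable_id' _)
    hf.aestronglyMeasurable,
    ← Measure.modularCharacterFun_eq_haarScalarFactor μ r, integral_smul_nnreal_measure] at h
  have h2 : (Measure.modularCharacterFun r : ℝ) = modularFn r⁻¹ := by
    rw [modularFn, inv_inv]; rfl
  rw [h, NNReal.smul_def, h2, smul_eq_mul, ← mul_assoc, mul_comm (modularFn r),
    modularFn_inv_mul, one_mul]

lemma continuous_modularFn [T2Space G] : Continuous (modularFn : G → ℝ) := by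
  borelize G
  let ν : Measure G := Measure.haar
  obtain ⟨⟨f, f_cont⟩, f_comp, f_nonneg, f_one⟩ :
    ∃ f : C(G, ℝ), HasCompactSupport f ∧ 0 ≤ f ∧ f 1 ≠ 0 := exists_continuous_nonneg_pos 1
  have hpos : 0 < ∫ x, f x ∂ν :=
    f_cont.integral_pos_of_hasCompactSupport_nonneg_nonzero f_comp f_nonneg f_one
  have key : ∀ r : G, modularFn r = (∫ s, f (s * r⁻¹) ∂ν) / ∫ s, f s ∂ν := by
    intro r
    rw [eq_div_iff hpos.ne', ← modularFn_mul_integral ν f f_cont f_comp r⁻¹, ← mul_assoc,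
      mul_comm (modularFn r), modularFn_inv_mul, one_mul]
  have hcont : Continuous fun r : G => ∫ s, f (s * r⁻¹) ∂ν := by
    rw [continuous_iff_continuousAt]
    intro r₀
    obtain ⟨K, hK, hKn⟩ := exists_compact_mem_nhds r₀
    have : ContinuousOn (fun r : G => ∫ s, f (s * r⁻¹) ∂ν) K := by
      refine continuousOn_integral_of_compact_support (k := tsupport f * K)
        (f_comp.isCompact.mul hK) ?_ ?_
      · exact (f_cont.comp (continuous_snd.mul continuous_fst.inv)).continuousOn
      · intro p x hp hx
        contrapose! hx
        exact ⟨x * p⁻¹, subset_tsupport f hx, p, hp, by simp⟩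
    exact this.continuousAt hKn
  simp_rw [funext key]
  exact hcont.div_const _

lemma integral_modularFn_inv [T2Space G] (φ : G → E) (hφ : Continuous φ)
    (hc : HasCompactSupport φ) :
    ∫ s, modularFn s⁻¹ • φ s⁻¹ ∂μ = ∫ s, φ s ∂μ := by
  obtain ⟨⟨f, f_cont⟩, f_comp, f_nonneg, f_one⟩ :
    ∃ f : C(G, ℝ), HasCompactSupport f ∧ 0 ≤ f ∧ f 1 ≠ 0 := exists_continuous_nonneg_pos 1
  simp only [ContinuousMap.coe_mk] at f_comp f_one
  have hpos : 0 < ∫ x, f x ∂μ :=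
    f_cont.integral_pos_of_hasCompactSupport_nonneg_nonzero f_comp f_nonneg f_one
  have h1 : ∀ t : G, ∫ s, f (s * t) • φ t⁻¹ ∂μ =
      (∫ s, f s ∂μ) • (modularFn t⁻¹ • φ t⁻¹) := by
    intro t
    rw [integral_smul_const, smul_smul, ← modularFn_mul_integral μ f f_cont f_comp t]
    congr 1
    rw [mul_comm (modularFn t), mul_assoc, mul_comm (modularFn t), modularFn_inv_mul, mul_one]
  have h2 : ∫ t, ∫ s, f (s * t) • φ t⁻¹ ∂μ ∂μ = ∫ s, ∫ t, f (s * t) • φ t⁻¹ ∂μ ∂μ := by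
    refine integral_integral_swap_of_hasCompactSupport (f := fun t s => f (s * t) • φ t⁻¹) ?_ ?_
    · exact (f_cont.comp (continuous_snd.mul continuous_fst)).smul
        (hφ.comp continuous_fst.inv)
    · refine HasCompactSupport.intro
        ((hc.isCompact.inv).prod (f_comp.isCompact.mul hc.isCompact)) ?_
      rintro ⟨t, s⟩ hts
      contrapose! hts
      simp only [Function.uncurry_apply_pair, ne_eq, smul_eq_zero, not_or] at hts
      refine ⟨?_, s * t, subset_tsupport f hts.1, t⁻¹, subset_tsupport φ hts.2, by simp⟩
      exact Set.mem_inv.2 (subset_tsupport φ hts.2)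
  have h3 : ∀ s : G, ∫ t, f (s * t) • φ t⁻¹ ∂μ = ∫ t, f t • φ (t⁻¹ * s) ∂μ := by
    intro s
    rw [← integral_mul_left_eq_self (fun t => f t • φ (t⁻¹ * s)) s]
    simp
  have h4 : ∫ s, ∫ t, f t • φ (t⁻¹ * s) ∂μ ∂μ = ∫ t, ∫ s, f t • φ (t⁻¹ * s) ∂μ ∂μ := by
    refine integral_integral_swap_of_hasCompactSupport (f := fun s t => f t • φ (t⁻¹ * s)) ?_ ?_
    · exact (f_cont.comp continuous_snd).smul (hφ.comp (continuous_snd.inv.mul continuous_fst))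
    · refine HasCompactSupport.intro
        ((f_comp.isCompact.mul hc.isCompact).prod f_comp.isCompact) ?_
      rintro ⟨s, t⟩ hts
      contrapose! hts
      simp only [Function.uncurry_apply_pair, ne_eq, smul_eq_zero, not_or] at hts
      exact ⟨⟨t, subset_tsupport f hts.1, t⁻¹ * s, subset_tsupport φ hts.2, by simp⟩,
        subset_tsupport f hts.1⟩
  have h5 : ∀ t : G, ∫ s, f t • φ (t⁻¹ * s) ∂μ = f t • ∫ s, φ s ∂μ := by
    intro t
    rw [integral_smul, integral_mul_left_eq_self]
  simp_rw [h1, h3] at h2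
  rw [integral_smul, h4] at h2
  simp_rw [h5] at h2
  rw [integral_smul_const] at h2
  exact smul_right_injective E hpos.ne' h2

end Haar

/-- An involutive Banach algebra dynamical system `(A, G, α)`: a strongly continuous action of
`G` on `A` by bounded involutive automorphisms. -/
structure InvolutiveSystem (A : Type u) (G : Type w) [NonUnitalNormedRing A] [NormedSpace ℂ A]
    [StarRing A] [Group G] [TopologicalSpace G] where
  act : G →* (A ≃⋆ₐ[ℂ] A)
  continuous_act : ∀ s, Continuous (act s)
  continuous_orbit : ∀ a, Continuous fun s => act s a

lemma jointly_continuous {G X : Type*} [TopologicalSpace G] [LocallyCompactSpace G]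
    [NormedAddCommGroup X] [NormedSpace ℂ X] [CompleteSpace X] (V : G → X →L[ℂ] X)
    (hV : ∀ x, Continuous fun s => V s x) : Continuous fun p : G × X => V p.1 p.2 := by
  rw [continuous_iff_continuousAt]
  rintro ⟨r, x⟩
  obtain ⟨K, hK, hKn⟩ := exists_compact_mem_nhds r
  obtain ⟨C, hC⟩ := banach_steinhaus (g := fun s : K => V s) (by
    intro y
    obtain ⟨C, hC⟩ := hK.exists_bound_of_continuousOn (hV y).continuousOn
    exact ⟨C, fun s => hC s s.2⟩)
  have h1 : Tendsto (fun p : G × X => C * ‖p.2 - x‖ + ‖V p.1 x - V r x‖) (𝓝 (r, x)) (𝓝 0) := by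
    have : Continuous fun p : G × X => C * ‖p.2 - x‖ + ‖V p.1 x - V r x‖ := by
      have := (hV x).comp (continuous_fst (X := G) (Y := X))
      simp only [Function.comp_def] at this
      fun_prop
    simpa using this.tendsto (r, x)
  rw [ContinuousAt, tendsto_iff_norm_sub_tendsto_zero]
  refine squeeze_zero' (Eventually.of_forall fun _ => norm_nonneg _) ?_ h1
  have : ∀ᶠ p : G × X in 𝓝 (r, x), p.1 ∈ K := continuous_fst.continuousAt.eventually hKn
  filter_upwards [this] with p hp
  have e : V p.1 p.2 - V r x = V p.1 (p.2 - x) + (V p.1 x - V r x) := by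
    rw [map_sub]; abel
  rw [e]
  refine (norm_add_le _ _).trans (add_le_add ?_ le_rfl)
  exact ((V p.1).le_opNorm _).trans (mul_le_mul_of_nonneg_right (hC ⟨_, hp⟩) (norm_nonneg _))

section Convolution

variable {A : Type u} {G : Type w} [NonUnitalNormedRing A] [NormedSpace ℂ A]
  [IsScalarTower ℂ A A] [SMulCommClass ℂ A A] [StarRing A] [StarModule ℂ A] [ContinuousStar A]
  [CompleteSpace A] [Group G] [TopologicalSpace G] [IsTopologicalGroup G]
  [LocallyCompactSpace G] [T2Space G]

/-- `α_s` as a bounded operator. -/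
def InvolutiveSystem.actL (α : InvolutiveSystem A G) (s : G) : A →L[ℂ] A where
  toFun a := α.act s a
  map_add' := map_add (α.act s)
  map_smul' c a := map_smul (α.act s) c a
  cont := α.continuous_act s

lemma InvolutiveSystem.actL_apply (α : InvolutiveSystem A G) (s : G) (a : A) :
    α.actL s a = α.act s a := rfl

lemma InvolutiveSystem.act_mul (α : InvolutiveSystem A G) (s t : G) (a : A) :
    α.act (s * t) a = α.act s (α.act t a) := by
  rw [map_mul]; rfl

lemma InvolutiveSystem.act_one (α : InvolutiveSystem A G) (a : A) : α.act 1 a = a := by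
  rw [map_one]; rfl

lemma InvolutiveSystem.continuous_act₂ (α : InvolutiveSystem A G) :
    Continuous fun p : G × A => α.act p.1 p.2 :=
  jointly_continuous α.actL α.continuous_orbit

variable (α : InvolutiveSystem A G) [MeasurableSpace G] [BorelSpace G] (μ : Measure G)
  [μ.IsHaarMeasure]

/-- The twisted convolution `[f * g](s) = ∫ f(r) α_r(g(r⁻¹ s)) dr`. -/
def twistedConv (f g : C_c(G, A)) : C_c(G, A) where
  toFun s := ∫ r, f r * α.act r (g (r⁻¹ * s)) ∂μ
  continuous_toFun := by
    rw [← continuousOn_univ]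
    refine continuousOn_integral_of_compact_support (k := tsupport f) f.hasCompactSupport ?_ ?_
    · refine Continuous.continuousOn ?_
      exact (f.continuous.comp continuous_snd).mul (α.continuous_act₂.comp
        (continuous_snd.prodMk (g.continuous.comp (continuous_snd.inv.mul continuous_fst))))
    · intro s r _ hr
      rw [image_eq_zero_of_notMem_tsupport hr, zero_mul]
  hasCompactSupport' := by
    refine HasCompactSupport.intro (f.hasCompactSupport.isCompact.mul
      g.hasCompactSupport.isCompact) ?_
    intro s hs
    refine integral_eq_zero_of_ae (Eventually.of_forall fun r => ?_)
    by_contra h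
    apply hs
    have hf : f r ≠ 0 := fun h0 => h (by simp [h0])
    have hg : g (r⁻¹ * s) ≠ 0 := fun h0 => h (by simp [h0])
    exact ⟨r, subset_tsupport f hf, r⁻¹ * s, subset_tsupport g hg, by simp⟩

/-- The involution `f^*(s) = Δ(s⁻¹) α_s(f(s⁻¹)^*)`. -/
def twistedStar (f : C_c(G, A)) : C_c(G, A) where
  toFun s := (modularFn s⁻¹ : ℂ) • α.act s (star (f s⁻¹))
  continuous_toFun := by
    refine Continuous.smul (Complex.continuous_ofReal.comp (continuous_modularFn.comp
      continuous_inv)) (α.continuous_act₂.comp (continuous_id.prodMk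
        (f.continuous.comp continuous_inv).star))
  hasCompactSupport' := by
    refine HasCompactSupport.intro f.hasCompactSupport.isCompact.inv ?_
    intro s hs
    have : f s⁻¹ = 0 := by
      by_contra h
      exact hs (Set.mem_inv.2 (subset_tsupport f h))
    simp [this]

lemma twistedConv_apply (f g : C_c(G, A)) (s : G) :
    twistedConv α μ f g s = ∫ r, f r * α.act r (g (r⁻¹ * s)) ∂μ := rfl

lemma twistedStar_apply (f : C_c(G, A)) (s : G) :
    twistedStar α f s = (modularFn s⁻¹ : ℂ) • α.act s (star (f s⁻¹)) := rfl

section Core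

variable {X : Type*} [NormedAddCommGroup X] [NormedSpace ℂ X] [CompleteSpace X]
  (P : A →L[ℂ] X →L[ℂ] X) (V : G → X →L[ℂ] X)

lemma continuous_integrand (hV : Continuous fun p : G × X => V p.1 p.2)
    (f : C_c(G, A)) (x : G → X) (hx : Continuous x) :
    Continuous fun s => P (f s) (V s (x s)) :=
  (P.continuous.comp f.continuous).clm_apply (hV.comp (continuous_id.prodMk hx))

lemma hasCompactSupport_integrand (f : C_c(G, A)) (x : G → X) :
    HasCompactSupport fun s => P (f s) (V s (x s)) := by
  refine HasCompactSupport.intro f.hasCompactSupport.isCompact fun s hs => ?_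
  rw [image_eq_zero_of_notMem_tsupport hs, map_zero, zero_apply]

lemma integrable_integrand (hV : Continuous fun p : G × X => V p.1 p.2)
    (f : C_c(G, A)) (x : G → X) (hx : Continuous x) :
    Integrable (fun s => P (f s) (V s (x s))) μ :=
  (continuous_integrand P V hV f x hx).integrable_of_hasCompactSupport
    (hasCompactSupport_integrand P V f x)

lemma integrable_conv (f g : C_c(G, A)) (s : G) :
    Integrable (fun r => f r * α.act r (g (r⁻¹ * s))) μ := by
  refine Continuous.integrable_of_hasCompactSupport ?_ ?_
  · exact f.continuous.mul (α.continuous_act₂.comp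
        (continuous_id.prodMk (g.continuous.comp (continuous_inv.mul continuous_const))))
  · refine HasCompactSupport.intro f.hasCompactSupport.isCompact fun s hs => ?_
    rw [image_eq_zero_of_notMem_tsupport hs, zero_mul]

lemma integral_twistedConv (hP : ∀ a b x, P (a * b) x = P a (P b x))
    (hVm : ∀ s t x, V (s * t) x = V s (V t x))
    (hV : Continuous fun p : G × X => V p.1 p.2)
    (hc : ∀ s a x, P (α.act s a) (V s x) = V s (P a x))
    (f g : C_c(G, A)) (x : G → X) (hx : Continuous x) :
    ∫ s, P (twistedConv α μ f g s) (V s (x s⁻¹)) ∂μ =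
      ∫ r, P (f r) (V r (∫ t, P (g t) (V t (x (t⁻¹ * r⁻¹))) ∂μ)) ∂μ := by
  have h1 : ∀ s, P (twistedConv α μ f g s) (V s (x s⁻¹)) =
      ∫ r, P (f r) (P (α.act r (g (r⁻¹ * s))) (V s (x s⁻¹))) ∂μ := by
    intro s
    rw [twistedConv_apply]
    have := (P.flip (V s (x s⁻¹))).integral_comp_comm (integrable_conv α μ f g s)
    simp only [ContinuousLinearMap.flip_apply] at this
    rw [← this]
    simp_rw [hP]
  simp_rw [h1]
  rw [integral_integral_swap_of_hasCompactSupport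
    (f := fun s r => P (f r) (P (α.act r (g (r⁻¹ * s))) (V s (x s⁻¹))))]
  · congr 1
    ext r
    rw [← integral_mul_left_eq_self _ r]
    have h2 : ∀ s, P (f r) (P (α.act r (g (r⁻¹ * (r * s)))) (V (r * s) (x (r * s)⁻¹))) =
        ((P (f r)).comp (V r)) (P (g s) (V s (x (s⁻¹ * r⁻¹)))) := by
      intro s
      rw [inv_mul_cancel_left, hVm, hc, mul_inv_rev]
      rfl
    simp_rw [h2]
    rw [ContinuousLinearMap.integral_comp_comm]
    · rfl
    · exact integrable_integrand μ P V hV g (fun s => x (s⁻¹ * r⁻¹))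
        (hx.comp (continuous_inv.mul continuous_const))
  · refine Continuous.clm_apply (P.continuous.comp (f.continuous.comp continuous_snd)) ?_
    refine Continuous.clm_apply (P.continuous.comp (α.continuous_act₂.comp
      (continuous_snd.prodMk (g.continuous.comp (continuous_snd.inv.mul continuous_fst))))) ?_
    exact hV.comp (continuous_fst.prodMk (hx.comp continuous_fst.inv))
  · refine HasCompactSupport.intro ((f.hasCompactSupport.isCompact.mul
      g.hasCompactSupport.isCompact).prod f.hasCompactSupport.isCompact) ?_
    rintro ⟨s, r⟩ h
    by_contra h0
    have hf : f r ≠ 0 := fun h1 => h0 (by simp [h1])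
    have hg : g (r⁻¹ * s) ≠ 0 := fun h1 => h0 (by simp [h1])
    exact h ⟨⟨r, subset_tsupport f hf, r⁻¹ * s, subset_tsupport g hg, by simp⟩,
      subset_tsupport f hf⟩

end Core

lemma twistedConv_assoc (f g h : C_c(G, A)) :
    twistedConv α μ (twistedConv α μ f g) h = twistedConv α μ f (twistedConv α μ g h) := by
  ext s
  have := integral_twistedConv α μ (X := A) (ContinuousLinearMap.mul ℂ A) α.actL
    (by simp [mul_assoc]) (by intro s t x; exact α.act_mul s t x) α.continuous_act₂
    (by intro s a x; simp [InvolutiveSystem.actL_apply]) f g (fun u => h (u * s))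
    (h.continuous.comp (continuous_id.mul continuous_const))
  simpa [InvolutiveSystem.actL_apply, twistedConv_apply, mul_assoc] using this

lemma twistedStar_twistedStar (f : C_c(G, A)) : twistedStar α (twistedStar α f) = f := by
  ext s
  rw [twistedStar_apply, twistedStar_apply, inv_inv, star_smul, map_smul, smul_smul, ← map_star,
    star_star, ← α.act_mul, mul_inv_cancel, α.act_one]
  have := modularFn_inv_mul s
  rw [Complex.star_def, Complex.conj_ofReal, ← Complex.ofReal_mul, this]
  simp

lemma twistedStar_twistedConv (f g : C_c(G, A)) :
    twistedStar α (twistedConv α μ f g) =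
      twistedConv α μ (twistedStar α g) (twistedStar α f) := by
  ext s
  rw [twistedStar_apply, twistedConv_apply, twistedConv_apply]
  rw [← integral_mul_left_eq_self (fun r => twistedStar α g r *
    α.act r (twistedStar α f (r⁻¹ * s))) s]
  have h1 := (starL' ℝ (A := A)).toContinuousLinearMap.integral_comp_comm
    (integrable_conv α μ f g s⁻¹)
  simp only [ContinuousLinearEquiv.coe_coe, starL'_apply] at h1
  rw [← h1, ← InvolutiveSystem.actL_apply, ← ContinuousLinearMap.integral_comp_comm, ← integral_smul]
  · congr 1
    ext r
    rw [twistedStar_apply, twistedStar_apply, InvolutiveSystem.actL_apply, star_mul, map_mul,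
      map_smul, smul_mul_smul_comm, ← α.act_mul, ← map_star, ← α.act_mul, ← Complex.ofReal_mul,
      ← modularFn_mul]
    have hΔ : modularFn (r⁻¹ * s⁻¹ * r) = modularFn s⁻¹ := by
      rw [modularFn_mul, modularFn_mul, mul_right_comm, modularFn_inv_mul, one_mul]
    simp [hΔ]
  · exact (starL' ℝ (A := A)).toContinuousLinearMap.integrable_comp (integrable_conv α μ f g s⁻¹)

end Convolution

/-- A (bundled) complex Hilbert space, so that a class of Hilbert spaces is a
`Set HilbertSp`. -/
structure HilbertSp where
  carrier : Type v
  [normedAddCommGroup : NormedAddCommGroup carrier]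
  [innerProductSpace : InnerProductSpace ℂ carrier]
  [completeSpace : CompleteSpace carrier]

instance : CoeSort HilbertSp.{v} (Type v) := ⟨HilbertSp.carrier⟩
instance (H : HilbertSp.{v}) : NormedAddCommGroup H := H.normedAddCommGroup
instance (H : HilbertSp.{v}) : InnerProductSpace ℂ H := H.innerProductSpace
instance (H : HilbertSp.{v}) : CompleteSpace H := H.completeSpace

section CrossedProduct

variable {A : Type u} {G : Type w} [NonUnitalNormedRing A] [NormedSpace ℂ A]
  [IsScalarTower ℂ A A] [SMulCommClass ℂ A A] [StarRing A] [StarModule ℂ A] [ContinuousStar A]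
  [CompleteSpace A] [Group G] [TopologicalSpace G] [IsTopologicalGroup G]
  [LocallyCompactSpace G] [T2Space G]

/-- A continuous covariant representation `(π, U)` of `(A, G, α)` on the Hilbert space `H` such
that `π` is contractive and involutive and every `U_s` is unitary. -/
structure CovRep (α : InvolutiveSystem A G) (H : Type v) [NormedAddCommGroup H]
    [InnerProductSpace ℂ H] [CompleteSpace H] where
  π : A →⋆ₙₐ[ℂ] (H →L[ℂ] H)
  U : G →* unitary (H →L[ℂ] H)
  contractive : ∀ a, ‖π a‖ ≤ ‖a‖
  continuous_orbit : ∀ x, Continuous fun s => (U s : H →L[ℂ] H) x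
  covariant : ∀ s a, π (α.act s a) = (U s : H →L[ℂ] H) * π a * (U s⁻¹ : H →L[ℂ] H)

/-- A representation by bounded operators is non-degenerate if the span of all `π(b) x` is
dense. -/
def IsNondegenerate {B H : Type*} [NormedAddCommGroup H] [InnerProductSpace ℂ H]
    (π : B → (H →L[ℂ] H)) : Prop :=
  Dense (Submodule.span ℂ {y : H | ∃ b x, y = π b x} : Set H)

variable {α : InvolutiveSystem A G}

namespace CovRep

variable {H : Type v} [NormedAddCommGroup H] [InnerProductSpace ℂ H] [CompleteSpace H]
  (ρ : CovRep α H)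

/-- `π` as a bounded linear map. -/
def πL : A →L[ℂ] (H →L[ℂ] H) :=
  LinearMap.mkContinuous
    { toFun := ρ.π, map_add' := map_add ρ.π, map_smul' := map_smul ρ.π } 1
    (fun a => by simpa using ρ.contractive a)

lemma πL_apply (a : A) : ρ.πL a = ρ.π a := rfl

/-- `U_s` as a bounded operator. -/
def UL (s : G) : H →L[ℂ] H := (ρ.U s : H →L[ℂ] H)

lemma UL_mul (s t : G) (x : H) : ρ.UL (s * t) x = ρ.UL s (ρ.UL t x) := by
  simp [UL]

lemma UL_one (x : H) : ρ.UL 1 x = x := by simp [UL]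

lemma norm_UL (s : G) (x : H) : ‖ρ.UL s x‖ = ‖x‖ :=
  ContinuousLinearMap.norm_map_of_mem_unitary (ρ.U s).2 x

lemma star_UL (s : G) : star (ρ.UL s) = ρ.UL s⁻¹ := by
  rw [UL, UL, map_inv, ← Unitary.star_eq_inv]; rfl

lemma continuous_UL₂ : Continuous fun p : G × H => ρ.UL p.1 p.2 :=
  jointly_continuous ρ.UL ρ.continuous_orbit

lemma covariant_apply (s : G) (a : A) (x : H) :
    ρ.π (α.act s a) (ρ.UL s x) = ρ.UL s (ρ.π a x) := by
  rw [ρ.covariant]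
  change ρ.UL s (ρ.π a (ρ.UL s⁻¹ (ρ.UL s x))) = _
  rw [← ρ.UL_mul, inv_mul_cancel, UL_one]

variable [MeasurableSpace G] [BorelSpace G] (μ : Measure G) [μ.IsHaarMeasure]

lemma integrable (f : C_c(G, A)) (x : H) : Integrable (fun s => ρ.π (f s) (ρ.UL s x)) μ :=
  integrable_integrand μ ρ.πL ρ.UL ρ.continuous_UL₂ f (fun _ => x) continuous_const

/-- The operator `x ↦ ∫ π(f(s)) U_s x ds`. -/
def integral (f : C_c(G, A)) : H →L[ℂ] H :=
  LinearMap.mkContinuous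
    { toFun := fun x => ∫ s, ρ.π (f s) ((ρ.U s : H →L[ℂ] H) x) ∂μ
      map_add' := fun x y => by
        simp_rw [map_add]
        exact integral_add (ρ.integrable μ f x) (ρ.integrable μ f y)
      map_smul' := fun c x => by
        simp_rw [map_smul]
        exact integral_smul c _ } (∫ s, ‖f s‖ ∂μ)
    (fun x => by
      refine (norm_integral_le_integral_norm _).trans ?_
      rw [← integral_mul_const]
      have hf : Integrable (fun s => ‖f s‖) μ :=
        (f.continuous.integrable_of_hasCompactSupport f.hasCompactSupport).norm
      refine integral_mono (ρ.integrable μ f x).norm (hf.mul_const _) fun s => ?_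
      refine ((ρ.π (f s)).le_opNorm _).trans ?_
      refine mul_le_mul (ρ.contractive _) (ρ.norm_UL s x).le (norm_nonneg _) (norm_nonneg _))

lemma integral_apply (f : C_c(G, A)) (x : H) :
    ρ.integral μ f x = ∫ s, ρ.π (f s) ((ρ.U s : H →L[ℂ] H) x) ∂μ := rfl

lemma norm_integral_le (f : C_c(G, A)) : ‖ρ.integral μ f‖ ≤ ∫ s, ‖f s‖ ∂μ :=
  LinearMap.mkContinuous_norm_le _ (integral_nonneg fun _ => norm_nonneg _) _

lemma integral_add (f g : C_c(G, A)) :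
    ρ.integral μ (f + g) = ρ.integral μ f + ρ.integral μ g := by
  ext x
  simp only [integral_apply, CompactlySupportedContinuousMap.add_apply, map_add, add_apply]
  exact MeasureTheory.integral_add (ρ.integrable μ f x) (ρ.integrable μ g x)

lemma integral_smul (c : ℂ) (f : C_c(G, A)) :
    ρ.integral μ (c • f) = c • ρ.integral μ f := by
  ext x
  simp only [integral_apply, CompactlySupportedContinuousMap.smul_apply, map_smul, smul_apply]
  exact MeasureTheory.integral_smul c _

lemma integral_twistedConv (f g : C_c(G, A)) :
    ρ.integral μ (twistedConv α μ f g) = ρ.integral μ f * ρ.integral μ g := by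
  ext x
  exact BanachCrossed.integral_twistedConv α μ ρ.πL ρ.UL
    (fun a b y => by simp [πL_apply]) ρ.UL_mul ρ.continuous_UL₂ ρ.covariant_apply f g
    (fun _ => x) continuous_const

lemma integral_twistedStar (f : C_c(G, A)) :
    ρ.integral μ (twistedStar α f) = star (ρ.integral μ f) := by
  rw [ContinuousLinearMap.star_eq_adjoint, ContinuousLinearMap.eq_adjoint_iff]
  intro x y
  have hcont : Continuous fun s => ρ.UL s⁻¹ (ρ.π (star (f s)) x) :=
    ρ.continuous_UL₂.comp (continuous_inv.prodMk
      ((ρ.πL.continuous.comp f.continuous.star).clm_apply continuous_const))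
  have hcomp : HasCompactSupport fun s => ρ.UL s⁻¹ (ρ.π (star (f s)) x) :=
    HasCompactSupport.intro f.hasCompactSupport.isCompact fun s hs => by
      rw [image_eq_zero_of_notMem_tsupport hs]; simp
  have h1 : ρ.integral μ (twistedStar α f) x = ∫ s, ρ.UL s⁻¹ (ρ.π (star (f s)) x) ∂μ := by
    rw [← integral_modularFn_inv μ _ hcont hcomp, integral_apply]
    congr 1
    ext s
    rw [twistedStar_apply, map_smul, smul_apply, inv_inv]
    erw [ρ.covariant_apply]
    exact (RCLike.real_smul_eq_coe_smul (K := ℂ) _ _).symm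
  rw [h1]
  change _ = inner ℂ x (∫ s, ρ.π (f s) (ρ.UL s y) ∂μ)
  rw [← integral_inner (𝕜 := ℂ) (ρ.integrable μ f y)]
  rw [← inner_conj_symm, ← integral_inner (hcont.integrable_of_hasCompactSupport hcomp),
    ← integral_conj]
  congr 1
  ext s
  rw [inner_conj_symm]
  rw [← ρ.star_UL, map_star, ContinuousLinearMap.star_eq_adjoint,
    ContinuousLinearMap.star_eq_adjoint, ContinuousLinearMap.adjoint_inner_left,
    ContinuousLinearMap.adjoint_inner_left]

end CovRep

section Completion

open UniformSpace

variable (E : Type*) [NonUnitalSeminormedRing E] [NormedSpace ℂ E] [IsScalarTower ℂ E E]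
  [SMulCommClass ℂ E E] [StarRing E] [StarModule ℂ E] [NormedStarGroup E]

/-- The continuous extension of the multiplication to the completion. -/
@[reducible] def completionMul : Mul (Completion E) :=
  ⟨fun a b => (Completion.isDenseInducing_coe.prodMap Completion.isDenseInducing_coe).extend
    (fun p : E × E => ((p.1 * p.2 : E) : Completion E)) (a, b)⟩

/-- The continuous extension of the involution to the completion. -/
@[reducible] def completionStar : Star (Completion E) :=
  ⟨Completion.map star⟩

attribute [local instance] completionMul completionStar

lemma completion_coe_mul (a b : E) : ((a * b : E) : Completion E) = a * b :=
  ((Completion.isDenseInducing_coe.prodMap Completion.isDenseInducing_coe).extend_eq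
      ((Completion.continuous_coe E).comp (continuous_mul (M := E))) (a, b)).symm

lemma completion_continuousMul : ContinuousMul (Completion E) where
  continuous_mul := by
    let m := (AddMonoidHom.mul : E →+ E →+ E).compr₂ Completion.toCompl
    have : Continuous fun p : E × E => m p.1 p.2 :=
      (Completion.continuous_coe E).comp continuous_mul
    have di : IsDenseInducing (Completion.toCompl : E → Completion E) :=
      Completion.isDenseInducing_coe
    exact (di.extend_Z_bilin di this :)

lemma completion_coe_star (a : E) : ((star a : E) : Completion E) = star (a : Completion E) :=
  (Completion.map_coe (starₗᵢ ℂ (E := E)).isometry.uniformContinuous a).symm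

lemma completion_continuousStar : ContinuousStar (Completion E) :=
  ⟨Completion.continuous_map⟩

attribute [local instance] completion_continuousMul completion_continuousStar

/-- The completion as a normed ring. -/
@[reducible] def completionRing : NonUnitalNormedRing (Completion E) :=
  { (inferInstance : NormedAddCommGroup (Completion E)), completionMul E with
    zero_mul := fun a => Completion.induction_on a (isClosed_eq (by fun_prop) continuous_const)
        fun a => by rw [← Completion.coe_zero, ← completion_coe_mul, zero_mul]
    mul_zero := fun a => Completion.induction_on a (isClosed_eq (by fun_prop) continuous_const)
        fun a => by rw [← Completion.coe_zero, ← completion_coe_mul, mul_zero]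
    mul_assoc := fun a b c => Completion.induction_on₃ a b c
        (isClosed_eq (by fun_prop) (by fun_prop))
        fun a b c => by simp only [← completion_coe_mul, mul_assoc]
    left_distrib := fun a b c => Completion.induction_on₃ a b c
        (isClosed_eq (by fun_prop) (by fun_prop))
        fun a b c => by simp only [← completion_coe_mul, ← Completion.coe_add, mul_add]
    right_distrib := fun a b c => Completion.induction_on₃ a b c
        (isClosed_eq (by fun_prop) (by fun_prop))
        fun a b c => by simp only [← completion_coe_mul, ← Completion.coe_add, add_mul]
    norm_mul_le := fun a b => Completion.induction_on₂ a b
        (isClosed_le (by fun_prop) (by fun_prop))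
        fun a b => by
          simp only [← completion_coe_mul, Completion.norm_coe]
          exact norm_mul_le a b }

attribute [local instance] completionRing

lemma completion_isScalarTower : IsScalarTower ℂ (Completion E) (Completion E) where
  smul_assoc c a b := Completion.induction_on₂ a b
    (isClosed_eq ((continuous_fst.const_smul c).mul continuous_snd)
      ((continuous_fst.mul continuous_snd).const_smul c))
    fun a b => by
      change (c • (a : Completion E)) * (b : Completion E) =
        c • ((a : Completion E) * (b : Completion E))
      rw [← Completion.coe_smul, ← completion_coe_mul, ← completion_coe_mul,
        ← Completion.coe_smul, smul_mul_assoc]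

lemma completion_smulCommClass : SMulCommClass ℂ (Completion E) (Completion E) where
  smul_comm c a b := Completion.induction_on₂ a b
    (isClosed_eq ((continuous_fst.mul continuous_snd).const_smul c)
      (continuous_fst.mul (continuous_snd.const_smul c)))
    fun a b => by
      change c • ((a : Completion E) * (b : Completion E)) =
        (a : Completion E) * (c • (b : Completion E))
      rw [← Completion.coe_smul, ← completion_coe_mul, ← completion_coe_mul,
        ← Completion.coe_smul, mul_smul_comm]

/-- The completion as a star ring. -/
@[reducible] def completionStarRing : StarRing (Completion E) :=
  { completionStar E with
    star_involutive := fun a => Completion.induction_on a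
      (isClosed_eq (by fun_prop) continuous_id)
      fun a => by rw [← completion_coe_star, ← completion_coe_star, star_star]
    star_mul := fun a b => Completion.induction_on₂ a b
      (isClosed_eq (by fun_prop) (by fun_prop))
      fun a b => by simp only [← completion_coe_star, ← completion_coe_mul, star_mul]
    star_add := fun a b => Completion.induction_on₂ a b
      (isClosed_eq (by fun_prop) (by fun_prop))
      fun a b => by simp only [← completion_coe_star, ← Completion.coe_add, star_add] }

attribute [local instance] completionStarRing

lemma completion_starModule : StarModule ℂ (Completion E) where
  star_smul c a := Completion.induction_on a
    (isClosed_eq (continuous_id.const_smul c).star (continuous_id.star.const_smul (star c)))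
    fun a => by
      rw [← Completion.coe_smul, ← completion_coe_star, ← completion_coe_star,
        ← Completion.coe_smul, star_smul]

/-- The extension of a contractive involutive homomorphism into a complete star algebra. -/
def completionExtend {B : Type*} [NonUnitalNormedRing B] [NormedSpace ℂ B] [StarRing B]
    [ContinuousStar B] [CompleteSpace B] (f : E →⋆ₙₐ[ℂ] B) (hf : ∀ a, ‖f a‖ ≤ ‖a‖) :
    Completion E →⋆ₙₐ[ℂ] B :=
  have hu : UniformContinuous f :=
    (LipschitzWith.of_dist_le_mul (K := 1) fun a b => by
      rw [dist_eq_norm, dist_eq_norm, ← map_sub]; simpa using hf (a - b)).uniformContinuous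
  { toFun := Completion.extension f
    map_smul' := fun c a => Completion.induction_on a
      (isClosed_eq (Completion.continuous_extension.comp (continuous_const_smul c))
        (Completion.continuous_extension.const_smul c))
      fun a => by
        rw [MonoidHom.id_apply, ← Completion.coe_smul, Completion.extension_coe hu,
          Completion.extension_coe hu, map_smul]
    map_zero' := by rw [← Completion.coe_zero, Completion.extension_coe hu, map_zero]
    map_add' := fun a b => Completion.induction_on₂ a b
      (isClosed_eq (Completion.continuous_extension.comp continuous_add)
        ((Completion.continuous_extension.comp continuous_fst).add
          (Completion.continuous_extension.comp continuous_snd)))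
      fun a b => by
        rw [← Completion.coe_add]
        simp only [Completion.extension_coe hu, map_add]
    map_mul' := fun a b => Completion.induction_on₂ a b
      (isClosed_eq (Completion.continuous_extension.comp continuous_mul)
        ((Completion.continuous_extension.comp continuous_fst).mul
          (Completion.continuous_extension.comp continuous_snd)))
      fun a b => by
        rw [← completion_coe_mul]
        simp only [Completion.extension_coe hu, map_mul]
    map_star' := fun a => Completion.induction_on a
      (isClosed_eq (Completion.continuous_extension.comp continuous_star)
        (Completion.continuous_extension.star))
      fun a => by
        rw [← completion_coe_star]
        simp only [Completion.extension_coe hu, map_star] }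

lemma completionExtend_coe {B : Type*} [NonUnitalNormedRing B] [NormedSpace ℂ B] [StarRing B]
    [ContinuousStar B] [CompleteSpace B] (f : E →⋆ₙₐ[ℂ] B) (hf : ∀ a, ‖f a‖ ≤ ‖a‖) (a : E) :
    completionExtend E f hf (a : Completion E) = f a :=
  Completion.extension_coe (LipschitzWith.of_dist_le_mul (K := 1) fun a b => by
      rw [dist_eq_norm, dist_eq_norm, ← map_sub]; simpa using hf (a - b)).uniformContinuous a

end Completion

variable [MeasurableSpace G] [BorelSpace G]

/-- The space `C_c(G, A)`, to carry twisted convolution, the twisted involution and the seminorm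
`σ^R` of a class `R` of covariant representations. -/
def CcAlgebra (α : InvolutiveSystem A G) (_μ : Measure G)
    (_R : Set (Σ H : HilbertSp.{v}, CovRep α H)) : Type (max u w) := C_c(G, A)

variable (μ : Measure G) [μ.IsHaarMeasure] (R : Set (Σ H : HilbertSp.{v}, CovRep α H))

namespace CcAlgebra

instance : AddCommGroup (CcAlgebra α μ R) := inferInstanceAs (AddCommGroup C_c(G, A))
instance : Module ℂ (CcAlgebra α μ R) := inferInstanceAs (Module ℂ C_c(G, A))
instance : FunLike (CcAlgebra α μ R) G A := inferInstanceAs (FunLike C_c(G, A) G A)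

/-- Twisted convolution. -/
instance : Mul (CcAlgebra α μ R) := ⟨fun f g => twistedConv α μ f g⟩

/-- Twisted involution. -/
instance : Star (CcAlgebra α μ R) := ⟨fun f => twistedStar α f⟩

variable {μ R}

lemma ext {f g : CcAlgebra α μ R} (h : ∀ s, f s = g s) : f = g := DFunLike.ext f g h

lemma add_apply (f g : CcAlgebra α μ R) (s : G) : (f + g) s = f s + g s := rfl

lemma smul_apply (c : ℂ) (f : CcAlgebra α μ R) (s : G) : (c • f) s = c • f s := rfl

lemma mul_apply (f g : CcAlgebra α μ R) (s : G) :
    (f * g) s = ∫ r, f r * α.act r (g (r⁻¹ * s)) ∂μ := rfl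

lemma star_apply (f : CcAlgebra α μ R) (s : G) :
    (star f) s = (modularFn s⁻¹ : ℂ) • α.act s (star (f s⁻¹)) := rfl

lemma integrable_mul (f g : CcAlgebra α μ R) (s : G) :
    Integrable (fun r => f r * α.act r (g (r⁻¹ * s))) μ := integrable_conv α μ f g s

instance : NonUnitalRing (CcAlgebra α μ R) :=
  { (inferInstance : AddCommGroup (CcAlgebra α μ R)),
    (inferInstance : Mul (CcAlgebra α μ R)) with
    zero_mul := fun f => ext fun s => by
      rw [mul_apply]
      exact (integral_congr_ae (Eventually.of_forall fun r => zero_mul _)).trans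
        (integral_zero _ _)
    mul_zero := fun f => ext fun s => by
      rw [mul_apply]
      refine (integral_congr_ae (Eventually.of_forall fun r => ?_)).trans (integral_zero _ _)
      change f r * α.act r 0 = 0
      rw [map_zero, mul_zero]
    left_distrib := fun f g h => ext fun s => by
      simp only [add_apply, mul_apply, map_add, mul_add]
      exact integral_add (integrable_mul f g s) (integrable_mul f h s)
    right_distrib := fun f g h => ext fun s => by
      simp only [add_apply, mul_apply, add_mul]
      exact integral_add (integrable_mul f h s) (integrable_mul g h s)
    mul_assoc := fun f g h => twistedConv_assoc α μ f g h }

instance : StarRing (CcAlgebra α μ R) :=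
  { (inferInstance : Star (CcAlgebra α μ R)) with
    star_involutive := fun f => twistedStar_twistedStar α f
    star_mul := fun f g => twistedStar_twistedConv α μ f g
    star_add := fun f g => ext fun s => by
      simp only [add_apply, star_apply, star_add, map_add, smul_add] }

instance : IsScalarTower ℂ (CcAlgebra α μ R) (CcAlgebra α μ R) where
  smul_assoc c f g := ext fun s => by
    change ((c • f) * g) s = (c • (f * g)) s
    simp only [smul_apply, mul_apply, smul_mul_assoc]
    exact integral_smul c _

instance : SMulCommClass ℂ (CcAlgebra α μ R) (CcAlgebra α μ R) where
  smul_comm c f g := ext fun s => by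
    change (c • (f * g)) s = (f * (c • g)) s
    simp only [smul_apply, mul_apply, map_smul, mul_smul_comm]
    exact (integral_smul c _).symm

instance : StarModule ℂ (CcAlgebra α μ R) where
  star_smul c f := ext fun s => by
    simp only [smul_apply, star_apply, star_smul, map_smul]
    rw [smul_comm]

/-- The integrated form `π ⋊ U` on `C_c(G, A)`. -/
def intForm {H : Type*} [NormedAddCommGroup H] [InnerProductSpace ℂ H] [CompleteSpace H]
    (ρ : CovRep α H) : CcAlgebra α μ R →⋆ₙₐ[ℂ] (H →L[ℂ] H) where
  toFun f := ρ.integral μ f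
  map_smul' c f := ρ.integral_smul μ c f
  map_zero' := by
    have := ρ.integral_smul μ 0 (0 : C_c(G, A))
    rw [zero_smul, zero_smul] at this
    exact this
  map_add' f g := ρ.integral_add μ f g
  map_mul' f g := ρ.integral_twistedConv μ f g
  map_star' f := ρ.integral_twistedStar μ f

lemma intForm_apply {H : Type*} [NormedAddCommGroup H] [InnerProductSpace ℂ H] [CompleteSpace H]
    (ρ : CovRep α H) (f : CcAlgebra α μ R) (x : H) :
    intForm ρ f x = ∫ s, ρ.π (f s) ((ρ.U s : H →L[ℂ] H) x) ∂μ := rfl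

/-- `σ^R(f) = sup {‖(π ⋊ U)(f)‖ : (π, U) ∈ R}`. -/
def sigma (f : CcAlgebra α μ R) : ℝ := ⨆ p : R, ‖intForm p.1.2 f‖

lemma bddAbove_sigma (f : CcAlgebra α μ R) :
    BddAbove (Set.range fun p : R => ‖intForm p.1.2 f‖) := by
  refine ⟨∫ s, ‖f s‖ ∂μ, ?_⟩
  rintro _ ⟨p, rfl⟩
  exact p.1.2.norm_integral_le μ f

lemma norm_intForm_le_sigma (p : R) (f : CcAlgebra α μ R) : ‖intForm p.1.2 f‖ ≤ sigma f :=
  le_ciSup (bddAbove_sigma f) p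

lemma sigma_nonneg (f : CcAlgebra α μ R) : 0 ≤ sigma f :=
  Real.iSup_nonneg fun _ => norm_nonneg _

instance : SeminormedAddCommGroup (CcAlgebra α μ R) :=
  AddGroupSeminorm.toSeminormedAddCommGroup
    { toFun := sigma
      map_zero' := by simp [sigma]
      add_le' := fun f g => Real.iSup_le (fun p => by
        rw [map_add]
        exact (norm_add_le _ _).trans (add_le_add (norm_intForm_le_sigma p f)
          (norm_intForm_le_sigma p g))) (add_nonneg (sigma_nonneg f) (sigma_nonneg g))
      neg' := fun f => by simp [sigma, map_neg] }

lemma norm_def (f : CcAlgebra α μ R) : ‖f‖ = sigma f := rfl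

instance : NonUnitalSeminormedRing (CcAlgebra α μ R) :=
  { (inferInstance : SeminormedAddCommGroup (CcAlgebra α μ R)),
    (inferInstance : NonUnitalRing (CcAlgebra α μ R)) with
    norm_mul_le := fun f g => Real.iSup_le (fun p => by
      rw [map_mul]
      exact (norm_mul_le _ _).trans (mul_le_mul (norm_intForm_le_sigma p f)
        (norm_intForm_le_sigma p g) (norm_nonneg _) (sigma_nonneg f)))
      (mul_nonneg (sigma_nonneg f) (sigma_nonneg g)) }

instance : NormedSpace ℂ (CcAlgebra α μ R) where
  norm_smul_le c f := Real.iSup_le (fun p => by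
    rw [map_smul, norm_smul]
    exact mul_le_mul_of_nonneg_left (norm_intForm_le_sigma p f) (norm_nonneg _))
    (mul_nonneg (norm_nonneg _) (sigma_nonneg f))

instance : NormedStarGroup (CcAlgebra α μ R) where
  norm_star_le f := le_of_eq (by simp only [norm_def, sigma, map_star, norm_star])

end CcAlgebra

variable (α) in
/-- The crossed product `(A ⋊_α G)^R`: the (Hausdorff) completion of `C_c(G, A)` for the
seminorm `σ^R`, i.e. the completion of `C_c(G, A) / ker σ^R`. -/
def CrossedProduct : Type (max u w) := UniformSpace.Completion (CcAlgebra α μ R)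

namespace CrossedProduct

instance : NonUnitalNormedRing (CrossedProduct α μ R) := completionRing (CcAlgebra α μ R)
instance : NormedSpace ℂ (CrossedProduct α μ R) :=
  inferInstanceAs (NormedSpace ℂ (UniformSpace.Completion (CcAlgebra α μ R)))
instance : CompleteSpace (CrossedProduct α μ R) :=
  inferInstanceAs (CompleteSpace (UniformSpace.Completion (CcAlgebra α μ R)))
instance : StarRing (CrossedProduct α μ R) := completionStarRing (CcAlgebra α μ R)
instance : StarModule ℂ (CrossedProduct α μ R) := completion_starModule (CcAlgebra α μ R)
instance : IsScalarTower ℂ (CrossedProduct α μ R) (CrossedProduct α μ R) :=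
  completion_isScalarTower (CcAlgebra α μ R)
instance : SMulCommClass ℂ (CrossedProduct α μ R) (CrossedProduct α μ R) :=
  completion_smulCommClass (CcAlgebra α μ R)

variable {μ R}

/-- The canonical map `q^R : C_c(G, A) → (A ⋊_α G)^R`. -/
def q : CcAlgebra α μ R →⋆ₙₐ[ℂ] CrossedProduct α μ R where
  toFun f := (f : UniformSpace.Completion (CcAlgebra α μ R))
  map_smul' c f := UniformSpace.Completion.coe_smul c f
  map_zero' := UniformSpace.Completion.coe_zero
  map_add' f g := UniformSpace.Completion.coe_add f g
  map_mul' f g := completion_coe_mul _ f g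
  map_star' f := completion_coe_star _ f

lemma norm_q (f : CcAlgebra α μ R) : ‖q f‖ = CcAlgebra.sigma f :=
  UniformSpace.Completion.norm_coe f

lemma denseRange_q : DenseRange (q : CcAlgebra α μ R → CrossedProduct α μ R) :=
  UniformSpace.Completion.denseRange_coe

/-- The representation `(π ⋊ U)^R` of the crossed product, for `(π, U) ∈ R`. -/
def integratedForm (p : R) : CrossedProduct α μ R →⋆ₙₐ[ℂ] (p.1.1 →L[ℂ] p.1.1) :=
  completionExtend (CcAlgebra α μ R) (CcAlgebra.intForm p.1.2)
    (CcAlgebra.norm_intForm_le_sigma p)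

lemma integratedForm_q (p : R) (f : CcAlgebra α μ R) :
    integratedForm p (q f) = CcAlgebra.intForm p.1.2 f :=
  completionExtend_coe _ _ _ _

end CrossedProduct

end CrossedProduct

/-- The class of all non-degenerate continuous covariant representations `(π, U)` in spaces from
`𝓗`, with `π` contractive and involutive and `U` unitary. -/
def nondegCovReps {A : Type u} {G : Type w} [NonUnitalNormedRing A] [NormedSpace ℂ A]
    [StarRing A] [Group G] [TopologicalSpace G] (α : InvolutiveSystem A G)
    (𝓗 : Set HilbertSp.{v}) : Set (Σ H : HilbertSp.{v}, CovRep α H) :=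
  {p | p.1 ∈ 𝓗 ∧ IsNondegenerate p.2.π}

/-- The non-degenerate involutive representations of a star algebra in spaces from `𝓗`. -/
def nondegStarReps (B : Type*) [NonUnitalNonAssocSemiring B] [DistribMulAction ℂ B] [Star B]
    (𝓗 : Set HilbertSp.{v}) : Set (Σ H : HilbertSp.{v}, (B →⋆ₙₐ[ℂ] (H →L[ℂ] H))) :=
  {T | T.1 ∈ 𝓗 ∧ IsNondegenerate T.2}

/-- `A` has an `M`-bounded approximate left identity: a net in the closed `M`-ball, here encoded
by a filter, with `u a → a` for all `a`. -/
def HasBoundedLeftApproxIdentity (A : Type*) [NonUnitalNormedRing A] (M : ℝ) : Prop :=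
  ∃ l : Filter A, l.NeBot ∧ (∀ᶠ u in l, ‖u‖ ≤ M) ∧ ∀ a : A, Tendsto (fun u => u * a) l (𝓝 a)

end BanachCrossed

end

open BanachCrossed

noncomputable section

namespace BanachCrossed

section StrongLimits

variable {ι H H' : Type*} [NormedAddCommGroup H] [NormedSpace ℂ H] [NormedAddCommGroup H']
  [NormedSpace ℂ H'] [CompleteSpace H']

/-- A bounded family of operators that converges strongly on a set with dense span converges
strongly to a bounded operator. -/
lemma exists_strong_limit {l : Filter ι} [l.NeBot] (S : ι → H →L[ℂ] H') {M : ℝ} (hM : 0 ≤ M)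
    (hb : ∀ᶠ i in l, ‖S i‖ ≤ M) {D : Set H} (hD : Dense (Submodule.span ℂ D : Set H))
    (h : ∀ x ∈ D, ∃ y, Tendsto (fun i => S i x) l (𝓝 y)) :
    ∃ S₀ : H →L[ℂ] H', ‖S₀‖ ≤ M ∧ ∀ x, Tendsto (fun i => S i x) l (𝓝 (S₀ x)) := by
  let K : Submodule ℂ H :=
    { carrier := {x | ∃ y, Tendsto (fun i => S i x) l (𝓝 y)}
      add_mem' := by
        rintro x x' ⟨y, hy⟩ ⟨y', hy'⟩
        exact ⟨y + y', by simpa using hy.add hy'⟩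
      zero_mem' := ⟨0, by simp⟩
      smul_mem' := by
        rintro c x ⟨y, hy⟩
        exact ⟨c • y, by simpa using hy.const_smul c⟩ }
  have hDK : Submodule.span ℂ D ≤ K := Submodule.span_le.2 h
  have hall : ∀ x, ∃ y, Tendsto (fun i => S i x) l (𝓝 y) := by
    intro x
    refine cauchy_map_iff_exists_tendsto.1 (Metric.cauchy_iff.2 ⟨inferInstance, fun ε hε => ?_⟩)
    obtain ⟨x', hx'D, hx'm⟩ := Metric.dense_iff.1 hD x (ε / (4 * (M + 1))) (by positivity)
    obtain ⟨y, hy⟩ := hDK hx'm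
    have hev := hy (Metric.ball_mem_nhds y (show 0 < ε / 4 by positivity))
    refine ⟨_, Filter.image_mem_map (Filter.inter_mem hb hev), ?_⟩
    have key : ∀ i, ‖S i‖ ≤ M → S i x' ∈ Metric.ball y (ε / 4) → dist (S i x) y < ε / 2 := by
      intro i hi hiy
      have h1 : dist (S i x) (S i x') ≤ ε / 4 := by
        rw [dist_eq_norm, ← map_sub]
        calc ‖S i (x - x')‖ ≤ M * ‖x - x'‖ := (S i).le_of_opNorm_le hi _
          _ ≤ (M + 1) * (ε / (4 * (M + 1))) := by
            rw [Metric.mem_ball, dist_comm, dist_eq_norm] at hx'D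
            gcongr
            linarith
          _ = ε / 4 := by field_simp
      calc dist (S i x) y ≤ dist (S i x) (S i x') + dist (S i x') y := dist_triangle _ _ _
        _ < ε / 4 + ε / 4 := add_lt_add_of_le_of_lt h1 hiy
        _ = ε / 2 := by ring
    rintro _ ⟨i, ⟨hi, hiy⟩, rfl⟩ _ ⟨j, ⟨hj, hjy⟩, rfl⟩
    calc dist (S i x) (S j x) ≤ dist (S i x) y + dist (S j x) y := dist_triangle_right _ _ _
      _ < ε / 2 + ε / 2 := add_lt_add (key i hi hiy) (key j hj hjy)
      _ = ε := by ring
  choose S₀ hS₀ using hall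
  let S₁ : H →ₗ[ℂ] H' :=
    { toFun := S₀
      map_add' := fun x y => tendsto_nhds_unique (hS₀ _) (by
        simpa using (hS₀ x).add (hS₀ y))
      map_smul' := fun c x => tendsto_nhds_unique (hS₀ _) (by
        simpa using (hS₀ x).const_smul c) }
  refine ⟨S₁.mkContinuous M fun x => ?_, S₁.mkContinuous_norm_le hM _, hS₀⟩
  exact le_of_tendsto (hS₀ x).norm (hb.mono fun i hi => (S i).le_of_opNorm_le hi _)

end StrongLimits

section Nondegenerate

variable {B H : Type*} [NormedAddCommGroup H] [InnerProductSpace ℂ H]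

lemma IsNondegenerate.ext {π : B → (H →L[ℂ] H)} (hπ : IsNondegenerate π) {X : Type*}
    [NormedAddCommGroup X] [NormedSpace ℂ X] {S S' : H →L[ℂ] X}
    (h : ∀ b x, S (π b x) = S' (π b x)) : S = S' := by
  refine ContinuousLinearMap.ext_on hπ ?_
  rintro _ ⟨b, x, rfl⟩
  exact h b x

lemma isNondegenerate_iff_orthogonal [CompleteSpace H] {π : B → (H →L[ℂ] H)} :
    IsNondegenerate π ↔ ∀ y, (∀ b x, inner ℂ y (π b x) = 0) → y = 0 := by
  rw [IsNondegenerate, Submodule.dense_iff_topologicalClosure_eq_top,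
    Submodule.topologicalClosure_eq_top_iff, Submodule.eq_bot_iff]
  refine forall_congr' fun y => imp_congr_left ?_
  constructor
  · intro hy b x
    rw [inner_eq_zero_symm]
    exact hy _ (Submodule.subset_span ⟨b, x, rfl⟩)
  · intro hy z hz
    induction hz using Submodule.span_induction with
    | mem z hz =>
      obtain ⟨b, x, rfl⟩ := hz
      rw [inner_eq_zero_symm]
      exact hy b x
    | zero => exact inner_zero_left _
    | add z z' _ _ h h' => rw [inner_add_left, h, h', add_zero]
    | smul c z _ h => rw [inner_smul_left, h, mul_zero]

variable [CompleteSpace H] {E : Type*} [MeasurableSpace E]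

lemma integral_mem_of_isClosed {μ : Measure E} {f : E → H} (hf : Integrable f μ)
    {K : Submodule ℂ H} (hK : IsClosed (K : Set H)) (h : ∀ s, f s ∈ K) : ∫ s, f s ∂μ ∈ K := by
  have : CompleteSpace K := hK.completeSpace_coe
  rw [← Submodule.starProjection_eq_self_iff, ← ContinuousLinearMap.integral_comp_comm _ hf]
  congr 1
  ext s
  exact Submodule.starProjection_eq_self_iff.2 (h s)

end Nondegenerate

section Multipliers

variable {B H : Type*} [NonUnitalCStarAlgebra B] [NormedAddCommGroup H] [InnerProductSpace ℂ H]
  [CompleteSpace H] (T : B →⋆ₙₐ[ℂ] (H →L[ℂ] H))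

variable (B) in
lemma exists_contractive_approxUnit : ∃ l : Filter B, l.NeBot ∧ (∀ᶠ e in l, ‖e‖ ≤ 1) ∧
    ∀ b, Tendsto (fun e => e * b) l (𝓝 b) := by
  let _ := CStarAlgebra.spectralOrder B
  have := CStarAlgebra.spectralOrderedRing B
  have h := CStarAlgebra.increasingApproximateUnit B
  exact ⟨_, h.neBot, h.eventually_norm, fun b => h.tendsto_mul_right b⟩

/-- A star representation as a bounded linear map. -/
def repL : B →L[ℂ] H →L[ℂ] H :=
  LinearMap.mkContinuous { toFun := T, map_add' := map_add T, map_smul' := map_smul T } 1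
    fun b => by simpa using NonUnitalStarAlgHom.norm_apply_le T b

lemma repL_apply (b : B) : repL T b = T b := rfl

variable {T} (hT : IsNondegenerate T)
include hT

/-- A non-degenerate star representation extends to left multipliers. -/
lemma exists_multiplier_extension (L : B →L[ℂ] B) (hL : ∀ c d, L (c * d) = L c * d) :
    ∃ S : H →L[ℂ] H, ‖S‖ ≤ ‖L‖ ∧ ∀ b x, S (T b x) = T (L b) x := by
  obtain ⟨l, hl, hl1, hlb⟩ := exists_contractive_approxUnit B
  have key : ∀ b x, Tendsto (fun e => T (L e) (T b x)) l (𝓝 (T (L b) x)) := by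
    intro b x
    have h1 : Continuous fun c => repL T (L c) x :=
      ((repL T).continuous.comp L.continuous).clm_apply continuous_const
    refine ((h1.tendsto b).comp (hlb b)).congr fun e => ?_
    simp only [Function.comp_apply, repL_apply, hL, map_mul, mul_apply_eq_comp]
  obtain ⟨S, hS, hS'⟩ := exists_strong_limit (l := l) (fun e => T (L e)) (norm_nonneg L)
    (hl1.mono fun e he => (NonUnitalStarAlgHom.norm_apply_le T _).trans
      ((L.le_opNorm e).trans (mul_le_of_le_one_right (norm_nonneg _) he))) hT (by
    rintro _ ⟨b, x, rfl⟩
    exact ⟨_, key b x⟩)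
  exact ⟨S, hS, fun b x => tendsto_nhds_unique (hS' _) (key b x)⟩

lemma tendsto_apply_approxUnit {l : Filter B} [l.NeBot] (hl : ∀ᶠ e in l, ‖e‖ ≤ 1)
    (hlb : ∀ b, Tendsto (fun e => e * b) l (𝓝 b)) (x : H) :
    Tendsto (fun e => T e x) l (𝓝 x) := by
  have key : ∀ b x, Tendsto (fun e => T e (T b x)) l (𝓝 (T b x)) := by
    intro b x
    have h1 : Continuous fun c => repL T c x := (repL T).continuous.clm_apply continuous_const
    refine ((h1.tendsto b).comp (hlb b)).congr fun e => ?_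
    simp only [Function.comp_apply, repL_apply, map_mul, mul_apply_eq_comp]
  obtain ⟨S, -, hS'⟩ := exists_strong_limit (l := l) (fun e => T e) zero_le_one
    (hl.mono fun e he => (NonUnitalStarAlgHom.norm_apply_le T _).trans he) hT (by
    rintro _ ⟨b, x, rfl⟩
    exact ⟨_, key b x⟩)
  have : S = ContinuousLinearMap.id ℂ H :=
    hT.ext fun b x => tendsto_nhds_unique (hS' _) (key b x)
  simpa [this] using hS' x

/-- The extension of a non-degenerate star representation to a left multiplier. -/
def multOp (L : B →L[ℂ] B) (hL : ∀ c d, L (c * d) = L c * d) : H →L[ℂ] H :=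
  (exists_multiplier_extension hT L hL).choose

lemma norm_multOp_le (L : B →L[ℂ] B) (hL : ∀ c d, L (c * d) = L c * d) :
    ‖multOp hT L hL‖ ≤ ‖L‖ :=
  (exists_multiplier_extension hT L hL).choose_spec.1

lemma multOp_apply (L : B →L[ℂ] B) (hL : ∀ c d, L (c * d) = L c * d) (b : B) (x : H) :
    multOp hT L hL (T b x) = T (L b) x :=
  (exists_multiplier_extension hT L hL).choose_spec.2 b x

lemma star_multOp (L L' : B →L[ℂ] B) (hL : ∀ c d, L (c * d) = L c * d)
    (hL' : ∀ c d, L' (c * d) = L' c * d) (h : ∀ c d, star (L c) * d = star c * L' d) :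
    star (multOp hT L hL) = multOp hT L' hL' := by
  have hstar : ∀ c x z, inner ℂ (T c x) z = inner ℂ x (T (star c) z) := by
    intro c x z
    rw [map_star, ContinuousLinearMap.star_eq_adjoint, ContinuousLinearMap.adjoint_inner_right]
  refine hT.ext fun d y => ?_
  refine ext_inner_left ℂ fun z => ?_
  have hz : innerSL ℂ (star (multOp hT L hL) (T d y)) =
      innerSL ℂ (multOp hT L' hL' (T d y)) := by
    refine hT.ext fun c x => ?_
    simp only [innerSL_apply_apply]
    rw [← inner_conj_symm, ← inner_conj_symm (multOp hT L' hL' (T d y))]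
    congr 1
    rw [ContinuousLinearMap.star_eq_adjoint, ContinuousLinearMap.adjoint_inner_right,
      multOp_apply, multOp_apply, hstar, hstar, ← mul_apply_eq_comp,
      ← mul_apply_eq_comp, ← map_mul, ← map_mul, h]
  have := DFunLike.congr_fun hz z
  simp only [innerSL_apply_apply] at this
  rw [← inner_conj_symm, this, inner_conj_symm]

end Multipliers

section CrossedProduct

variable {A : Type u} {G : Type w} [NonUnitalNormedRing A] [NormedSpace ℂ A]
  [IsScalarTower ℂ A A] [SMulCommClass ℂ A A] [StarRing A] [StarModule ℂ A] [ContinuousStar A]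
  [CompleteSpace A] [Group G] [TopologicalSpace G] [IsTopologicalGroup G]
  [LocallyCompactSpace G] [T2Space G] [MeasurableSpace G] [BorelSpace G]
  {α : InvolutiveSystem A G} {μ : Measure G} [μ.IsHaarMeasure]
  {R : Set (Σ H : HilbertSp.{v}, CovRep α H)}

namespace CovRep

lemma act_apply {H : Type v} [NormedAddCommGroup H] [InnerProductSpace ℂ H]
    [CompleteSpace H] (ρ : CovRep α H) (s : G) (a : A) :
    ρ.π (α.act s a) = ρ.UL s * ρ.π a * ρ.UL s⁻¹ := ρ.covariant s a

@[ext]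
lemma ext {H : Type v} [NormedAddCommGroup H] [InnerProductSpace ℂ H]
    [CompleteSpace H] {ρ ρ' : CovRep α H} (hπ : ∀ a, ρ.π a = ρ'.π a)
    (hU : ∀ s, ρ.UL s = ρ'.UL s) : ρ = ρ' := by
  obtain ⟨π, U, _, _, _⟩ := ρ
  obtain ⟨π', U', _, _, _⟩ := ρ'
  obtain rfl : π = π' := DFunLike.ext _ _ hπ
  obtain rfl : U = U' := MonoidHom.ext fun s => Subtype.ext (hU s)
  rfl

end CovRep

namespace CcAlgebra

lemma continuous (f : CcAlgebra α μ R) : Continuous f :=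
  map_continuous (show C_c(G, A) from f)

lemma hasCompactSupport (f : CcAlgebra α μ R) : HasCompactSupport f :=
  CompactlySupportedContinuousMap.hasCompactSupport (show C_c(G, A) from f)

/-- A continuous compactly supported function as an element of the convolution algebra. -/
def mk (f : G → A) (hf : Continuous f) (hc : HasCompactSupport f) : CcAlgebra α μ R :=
  (⟨⟨f, hf⟩, hc⟩ : C_c(G, A))

lemma mk_apply (f : G → A) (hf : Continuous f) (hc : HasCompactSupport f) (s : G) :
    (mk f hf hc : CcAlgebra α μ R) s = f s := rfl

/-- Left multiplication of functions by elements of `A`. -/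
def leftMul (a : A) : CcAlgebra α μ R →ₗ[ℂ] CcAlgebra α μ R where
  toFun f := mk (fun s => a * f s) (continuous_const.mul f.continuous)
    f.hasCompactSupport.mul_left
  map_add' f g := ext fun s => mul_add a (f s) (g s)
  map_smul' c f := ext fun s => mul_smul_comm c a (f s)

/-- Left translation of functions, twisted by the action. -/
def translate (s : G) : CcAlgebra α μ R →ₗ[ℂ] CcAlgebra α μ R where
  toFun f := mk (fun t => α.act s (f (s⁻¹ * t)))
    ((α.continuous_act s).comp (f.continuous.comp (continuous_const.mul continuous_id)))
    ((f.hasCompactSupport.comp_homeomorph (Homeomorph.mulLeft s⁻¹)).comp_left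
      (g := α.act s) (map_zero _))
  map_add' f g := ext fun t => map_add (α.act s) (f (s⁻¹ * t)) (g (s⁻¹ * t))
  map_smul' c f := ext fun t => map_smul (α.act s) c (f (s⁻¹ * t))

lemma leftMul_apply (a : A) (f : CcAlgebra α μ R) (s : G) : leftMul a f s = a * f s := rfl

lemma translate_apply (s : G) (f : CcAlgebra α μ R) (t : G) :
    translate s f t = α.act s (f (s⁻¹ * t)) := rfl

section

variable {H : Type v} [NormedAddCommGroup H] [InnerProductSpace ℂ H] [CompleteSpace H]
  (ρ : CovRep α H)

lemma intForm_apply_UL (f : CcAlgebra α μ R) (x : H) :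
    intForm ρ f x = ∫ s, ρ.π (f s) (ρ.UL s x) ∂μ := rfl

lemma integrable_intForm (f : CcAlgebra α μ R) (x : H) :
    Integrable (fun s => ρ.π (f s) (ρ.UL s x)) μ := ρ.integrable μ f x

lemma intForm_leftMul (a : A) (f : CcAlgebra α μ R) :
    intForm ρ (leftMul a f) = ρ.π a * intForm ρ f := by
  ext x
  rw [mul_apply_eq_comp, intForm_apply_UL, intForm_apply_UL,
    ← ContinuousLinearMap.integral_comp_comm _ (integrable_intForm ρ f x)]
  simp only [leftMul_apply, map_mul, mul_apply_eq_comp]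

lemma intForm_translate (s : G) (f : CcAlgebra α μ R) :
    intForm ρ (translate s f) = ρ.UL s * intForm ρ f := by
  ext x
  rw [mul_apply_eq_comp, intForm_apply_UL, intForm_apply_UL,
    ← ContinuousLinearMap.integral_comp_comm _ (integrable_intForm ρ f x),
    ← integral_mul_left_eq_self _ s]
  congr 1
  ext t
  rw [translate_apply, inv_mul_cancel_left]
  rw [ρ.UL_mul, ρ.covariant_apply]

end

lemma sigma_le_integral_norm (f : CcAlgebra α μ R) : sigma f ≤ ∫ s, ‖f s‖ ∂μ :=
  Real.iSup_le (fun p => p.1.2.norm_integral_le μ f) (integral_nonneg fun _ => norm_nonneg _)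

lemma sigma_le {f : CcAlgebra α μ R} {M : ℝ} (hM : 0 ≤ M)
    (h : ∀ p : R, ‖intForm p.1.2 f‖ ≤ M) : sigma f ≤ M := Real.iSup_le h hM

lemma sigma_leftMul_le (a : A) (f : CcAlgebra α μ R) :
    sigma (leftMul a f) ≤ ‖a‖ * sigma f :=
  sigma_le (mul_nonneg (norm_nonneg _) (sigma_nonneg _)) fun p => by
    rw [intForm_leftMul]
    exact (norm_mul_le _ _).trans (mul_le_mul (p.1.2.contractive a) (norm_intForm_le_sigma p f)
      (norm_nonneg _) (norm_nonneg _))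

lemma sigma_translate_le (s : G) (f : CcAlgebra α μ R) :
    sigma (translate s f) ≤ 1 * sigma f :=
  sigma_le (by simpa using sigma_nonneg f) fun p => by
    rw [intForm_translate]
    refine (norm_mul_le _ _).trans (mul_le_mul ?_ (norm_intForm_le_sigma p f)
      (norm_nonneg _) zero_le_one)
    exact ContinuousLinearMap.opNorm_le_bound _ zero_le_one fun x => by
      rw [p.1.2.norm_UL, one_mul]

lemma sigma_mul_self_le (f : CcAlgebra α μ R) : sigma f * sigma f ≤ sigma (star f * f) := by
  rw [← sq]
  refine (Real.le_sqrt (sigma_nonneg _) (sigma_nonneg _)).1 ?_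
  refine sigma_le (Real.sqrt_nonneg _) fun p => Real.le_sqrt_of_sq_le ?_
  rw [sq, ← CStarRing.norm_star_mul_self, ← map_star, ← map_mul]
  exact norm_intForm_le_sigma p _

end CcAlgebra

namespace CrossedProduct

open CcAlgebra

instance : CStarRing (CrossedProduct α μ R) where
  norm_mul_self_le c := by
    let _ := completionRing (CcAlgebra α μ R)
    let _ := completionStarRing (CcAlgebra α μ R)
    have := completion_continuousMul (CcAlgebra α μ R)
    have := completion_continuousStar (CcAlgebra α μ R)
    refine UniformSpace.Completion.induction_on (α := CcAlgebra α μ R)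
      (p := fun c => ‖c‖ * ‖c‖ ≤ ‖star c * c‖) c
      (isClosed_le (by fun_prop) (by fun_prop)) fun f => ?_
    rw [← completion_coe_star, ← completion_coe_mul]
    simp only [UniformSpace.Completion.norm_coe]
    exact sigma_mul_self_le f

instance : NonUnitalCStarAlgebra (CrossedProduct α μ R) where

lemma eq_zero_of_integratedForm {c : CrossedProduct α μ R}
    (h : ∀ p : R, integratedForm p c = 0) : c = 0 := by
  refine norm_le_zero_iff.1 (le_of_forall_pos_le_add fun ε hε => ?_)
  obtain ⟨_, hd, f, rfl⟩ := Metric.dense_iff.1 (denseRange_q (α := α) (μ := μ) (R := R)) c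
    (ε / 2) (by positivity)
  rw [Metric.mem_ball, dist_eq_norm] at hd
  have h1 : ‖q f‖ ≤ ε / 2 := by
    rw [norm_q]
    refine sigma_le (by positivity) fun p => ?_
    rw [← integratedForm_q, ← sub_zero (integratedForm p (q f)), ← h p, ← map_sub]
    exact (NonUnitalStarAlgHom.norm_apply_le _ _).trans hd.le
  calc ‖c‖ = ‖q f - (q f - c)‖ := by rw [sub_sub_cancel]
    _ ≤ ‖q f‖ + ‖q f - c‖ := norm_sub_le _ _
    _ ≤ 0 + ε := by linarith

lemma ext_integratedForm {c d : CrossedProduct α μ R}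
    (h : ∀ p : R, integratedForm p c = integratedForm p d) : c = d :=
  sub_eq_zero.1 (eq_zero_of_integratedForm fun p => by rw [map_sub, h, sub_self])

variable (α μ R) in
/-- `q` as a bounded linear map. -/
def qL : CcAlgebra α μ R →L[ℂ] CrossedProduct α μ R :=
  LinearMap.mkContinuous { toFun := q, map_add' := map_add q, map_smul' := map_smul q } 1
    fun f => by rw [one_mul]; exact (norm_q f).le

lemma isUniformInducing_qL : IsUniformInducing (qL α μ R) :=
  UniformSpace.Completion.isUniformInducing_coe _

/-- The extension to the crossed product of a bounded linear map on `C_c(G, A)`. -/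
def extendMap (m : CcAlgebra α μ R →ₗ[ℂ] CcAlgebra α μ R) (M : ℝ)
    (hm : ∀ f, sigma (m f) ≤ M * sigma f) : CrossedProduct α μ R →L[ℂ] CrossedProduct α μ R :=
  ((qL α μ R).comp (m.mkContinuous M hm)).extend (qL α μ R)

section

variable (m : CcAlgebra α μ R →ₗ[ℂ] CcAlgebra α μ R) (M : ℝ)
    (hm : ∀ f, sigma (m f) ≤ M * sigma f)

lemma extendMap_q (f : CcAlgebra α μ R) : extendMap m M hm (q f) = q (m f) :=
  ContinuousLinearMap.extend_eq _ denseRange_q isUniformInducing_qL f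

lemma norm_extendMap_le (hM : 0 ≤ M) : ‖extendMap m M hm‖ ≤ M := by
  refine ContinuousLinearMap.opNorm_le_bound _ hM fun c => ?_
  refine denseRange_q.induction_on (p := fun c => ‖extendMap m M hm c‖ ≤ M * ‖c‖) c
    (isClosed_le (by fun_prop) (by fun_prop)) fun f => ?_
  rw [extendMap_q, norm_q, norm_q]
  exact hm f

lemma integratedForm_extendMap (p : R) (S : p.1.1 →L[ℂ] p.1.1)
    (h : ∀ f, intForm p.1.2 (m f) = S * intForm p.1.2 f) (c : CrossedProduct α μ R) :
    integratedForm p (extendMap m M hm c) = S * integratedForm p c := by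
  have hc : Continuous (integratedForm (μ := μ) p) := (repL (integratedForm p)).continuous
  refine denseRange_q.induction_on
    (p := fun c => integratedForm p (extendMap m M hm c) = S * integratedForm p c) c
    (isClosed_eq (by fun_prop) (by fun_prop)) fun f => ?_
  rw [extendMap_q, integratedForm_q, integratedForm_q, h]

end

variable (α μ R) in
/-- Left multiplication by `s ∈ G` on the crossed product. -/
def leftG (s : G) : CrossedProduct α μ R →L[ℂ] CrossedProduct α μ R :=
  extendMap (translate s) 1 (sigma_translate_le s)

lemma leftG_q (s : G) (f : CcAlgebra α μ R) : leftG α μ R s (q f) = q (translate s f) :=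
  extendMap_q _ _ _ f

lemma norm_leftG_le (s : G) : ‖leftG α μ R s‖ ≤ 1 := norm_extendMap_le _ _ (sigma_translate_le s) zero_le_one

lemma integratedForm_leftG (p : R) (s : G) (c : CrossedProduct α μ R) :
    integratedForm p (leftG α μ R s c) = p.1.2.UL s * integratedForm p c :=
  integratedForm_extendMap _ _ _ p _ (intForm_translate p.1.2 s) c

lemma leftG_mul (s : G) (c d : CrossedProduct α μ R) :
    leftG α μ R s (c * d) = leftG α μ R s c * d :=
  ext_integratedForm fun p => by simp only [integratedForm_leftG, map_mul, mul_assoc]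

variable (α μ R) in
/-- Left multiplication by `a ∈ A` on the crossed product, as a bounded operator. -/
def leftAOp (a : A) : CrossedProduct α μ R →L[ℂ] CrossedProduct α μ R :=
  extendMap (leftMul a) ‖a‖ (sigma_leftMul_le a)

lemma integratedForm_leftAOp (p : R) (a : A) (c : CrossedProduct α μ R) :
    integratedForm p (leftAOp α μ R a c) = p.1.2.π a * integratedForm p c :=
  integratedForm_extendMap _ _ _ p _ (intForm_leftMul p.1.2 a) c

variable (α μ R) in
/-- The action of `A` on the crossed product by left multiplication. -/
def leftA : A →L[ℂ] CrossedProduct α μ R →L[ℂ] CrossedProduct α μ R :=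
  LinearMap.mkContinuous
    { toFun := leftAOp α μ R
      map_add' := fun a b => ContinuousLinearMap.ext fun c => ext_integratedForm fun p => by
        simp only [integratedForm_leftAOp, map_add, _root_.add_apply, add_mul]
      map_smul' := fun z a => ContinuousLinearMap.ext fun c => ext_integratedForm fun p => by
        simp only [integratedForm_leftAOp, map_smul, _root_.smul_apply, smul_mul_assoc,
          RingHom.id_apply] } 1
    fun a => by rw [one_mul]; exact norm_extendMap_le _ _ (sigma_leftMul_le a) (norm_nonneg a)

lemma leftA_q (a : A) (f : CcAlgebra α μ R) : leftA α μ R a (q f) = q (leftMul a f) :=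
  extendMap_q _ _ _ f

lemma norm_leftA_le (a : A) : ‖leftA α μ R a‖ ≤ ‖a‖ := norm_extendMap_le _ _ (sigma_leftMul_le a) (norm_nonneg a)

lemma integratedForm_leftA (p : R) (a : A) (c : CrossedProduct α μ R) :
    integratedForm p (leftA α μ R a c) = p.1.2.π a * integratedForm p c :=
  integratedForm_leftAOp p a c

lemma leftA_mul (a : A) (c d : CrossedProduct α μ R) :
    leftA α μ R a (c * d) = leftA α μ R a c * d :=
  ext_integratedForm fun p => by simp only [integratedForm_leftA, map_mul, mul_assoc]

lemma leftA_mul_left (a b : A) (c : CrossedProduct α μ R) :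
    leftA α μ R (a * b) c = leftA α μ R a (leftA α μ R b c) :=
  ext_integratedForm fun p => by simp only [integratedForm_leftA, map_mul, mul_assoc]

lemma leftG_one (c : CrossedProduct α μ R) : leftG α μ R 1 c = c :=
  ext_integratedForm fun p => by
    rw [integratedForm_leftG]
    ext x
    exact p.1.2.UL_one _

lemma leftG_mul_left (s t : G) (c : CrossedProduct α μ R) :
    leftG α μ R (s * t) c = leftG α μ R s (leftG α μ R t c) :=
  ext_integratedForm fun p => by
    simp only [integratedForm_leftG]
    ext x
    exact p.1.2.UL_mul s t _

lemma leftA_act (s : G) (a : A) (c : CrossedProduct α μ R) :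
    leftA α μ R (α.act s a) c = leftG α μ R s (leftA α μ R a (leftG α μ R s⁻¹ c)) :=
  ext_integratedForm fun p => by
    simp only [integratedForm_leftA, integratedForm_leftG, p.1.2.act_apply, mul_assoc]

lemma star_leftA_mul (a : A) (c d : CrossedProduct α μ R) :
    star (leftA α μ R a c) * d = star c * leftA α μ R (star a) d :=
  ext_integratedForm fun p => by
    simp only [integratedForm_leftA, map_mul, map_star, star_mul, mul_assoc]

lemma star_leftG_mul (s : G) (c d : CrossedProduct α μ R) :
    star (leftG α μ R s c) * d = star c * leftG α μ R s⁻¹ d :=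
  ext_integratedForm fun p => by
    simp only [integratedForm_leftG, map_mul, map_star, star_mul, mul_assoc, p.1.2.star_UL]

lemma continuous_leftG_q (f : CcAlgebra α μ R) : Continuous fun s => leftG α μ R s (q f) := by
  rw [continuous_iff_continuousAt]
  intro r
  obtain ⟨K, hK, hKn⟩ := exists_compact_mem_nhds r
  have hcont : Continuous fun x : G × G => ‖translate x.1 f x.2 - translate r f x.2‖ := by
    refine Continuous.norm (Continuous.sub ?_ ?_)
    · exact α.continuous_act₂.comp (continuous_fst.prodMk
        (f.continuous.comp (continuous_fst.inv.mul continuous_snd)))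
    · exact (translate r f).continuous.comp continuous_snd
  have hint : ContinuousOn (fun s => ∫ t, ‖translate s f t - translate r f t‖ ∂μ) K := by
    refine continuousOn_integral_of_compact_support (k := K * tsupport f)
      (hK.mul f.hasCompactSupport.isCompact) hcont.continuousOn ?_
    intro s t hs ht
    have hr := mem_of_mem_nhds hKn
    have key : ∀ s ∈ K, translate s f t = 0 := by
      intro s hs
      rw [CcAlgebra.translate_apply, image_eq_zero_of_notMem_tsupport (f := f), map_zero]
      exact fun h => ht ⟨s, hs, _, h, by simp⟩
    rw [key s hs, key r hr, sub_zero, norm_zero]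
  have h0 : Tendsto (fun s => ∫ t, ‖translate s f t - translate r f t‖ ∂μ) (𝓝 r) (𝓝 0) := by
    simpa using (hint.continuousAt hKn).tendsto
  rw [ContinuousAt, tendsto_iff_norm_sub_tendsto_zero]
  refine squeeze_zero (fun _ => norm_nonneg _) (fun s => ?_) h0
  rw [leftG_q, leftG_q, ← map_sub, norm_q]
  refine (sigma_le_integral_norm _).trans (le_of_eq ?_)
  rfl

lemma continuous_leftG (c : CrossedProduct α μ R) : Continuous fun s => leftG α μ R s c := by
  rw [continuous_iff_continuousAt]
  intro r
  rw [ContinuousAt, Metric.tendsto_nhds]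
  intro ε hε
  obtain ⟨_, hd, f, rfl⟩ := Metric.dense_iff.1 (denseRange_q (α := α) (μ := μ) (R := R)) c
    (ε / 3) (by positivity)
  rw [Metric.mem_ball, dist_eq_norm] at hd
  have h1 : ∀ s, dist (leftG α μ R s c) (leftG α μ R s (q f)) < ε / 3 := fun s => by
    rw [dist_comm, dist_eq_norm, ← map_sub]
    refine ((leftG α μ R s).le_of_opNorm_le (norm_leftG_le s) _).trans_lt ?_
    rwa [one_mul]
  filter_upwards [Metric.tendsto_nhds.1 ((continuous_leftG_q f).tendsto r) (ε / 3)
    (by positivity)] with s hs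
  have h2 := h1 r
  rw [dist_comm] at h2
  have := dist_triangle4 (leftG α μ R s c) (leftG α μ R s (q f)) (leftG α μ R r (q f))
    (leftG α μ R r c)
  linarith [h1 s]

lemma integrable_leftA_leftG (f : CcAlgebra α μ R) (c : CrossedProduct α μ R) :
    Integrable (fun s => leftA α μ R (f s) (leftG α μ R s c)) μ := by
  refine Continuous.integrable_of_hasCompactSupport ?_ ?_
  · exact ((leftA α μ R).continuous.comp f.continuous).clm_apply (continuous_leftG c)
  · refine HasCompactSupport.intro f.hasCompactSupport.isCompact fun s hs => ?_
    rw [image_eq_zero_of_notMem_tsupport hs, map_zero, zero_apply]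

lemma q_mul (f : CcAlgebra α μ R) (c : CrossedProduct α μ R) :
    q f * c = ∫ s, leftA α μ R (f s) (leftG α μ R s c) ∂μ := by
  refine ext_integratedForm fun p => ContinuousLinearMap.ext fun x => ?_
  have h := ((repL (integratedForm p)).flip x).integral_comp_comm (integrable_leftA_leftG f c)
  simp only [ContinuousLinearMap.flip_apply, repL_apply, integratedForm_leftA,
    integratedForm_leftG] at h
  rw [← h, map_mul, mul_apply_eq_comp, integratedForm_q, intForm_apply]
  rfl

lemma continuous_repL_apply {H : Type*} [NormedAddCommGroup H] [InnerProductSpace ℂ H]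
    [CompleteSpace H] (T : CrossedProduct α μ R →⋆ₙₐ[ℂ] (H →L[ℂ] H)) : Continuous T :=
  (repL T).continuous

section Integration

lemma isNondegenerate_integratedForm (p : R) (hp : IsNondegenerate p.1.2.π) :
    IsNondegenerate (integratedForm (μ := μ) p) := by
  rw [isNondegenerate_iff_orthogonal] at hp ⊢
  intro y hy
  refine hp y fun a x => ?_
  by_contra hne
  let h : G → ℂ := fun s => inner ℂ y (p.1.2.π a (p.1.2.UL s x))
  have hh : Continuous h :=
    continuous_const.inner ((p.1.2.π a).continuous.comp (p.1.2.continuous_orbit x))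
  obtain ⟨⟨ψ, ψ_cont⟩, ψ_comp, ψ_nonneg, ψ_one⟩ :
    ∃ ψ : C(G, ℝ), HasCompactSupport ψ ∧ 0 ≤ ψ ∧ ψ 1 ≠ 0 := exists_continuous_nonneg_pos 1
  simp only [ContinuousMap.coe_mk] at ψ_comp ψ_one
  have hcont : Continuous fun s => ((ψ s : ℂ) * starRingEnd ℂ (h s)) • a := by fun_prop
  have hcomp : HasCompactSupport fun s => ((ψ s : ℂ) * starRingEnd ℂ (h s)) • a :=
    HasCompactSupport.intro ψ_comp.isCompact fun s hs => by
      simp [image_eq_zero_of_notMem_tsupport hs]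
  have h1 := hy (q (CcAlgebra.mk _ hcont hcomp)) x
  rw [integratedForm_q, intForm_apply_UL, ← integral_inner (integrable_intForm _ _ _)] at h1
  have h2 : ∀ s, inner ℂ y (p.1.2.π ((CcAlgebra.mk _ hcont hcomp : CcAlgebra α μ R) s)
      (p.1.2.UL s x)) = ((ψ s * ‖h s‖ ^ 2 : ℝ) : ℂ) := by
    intro s
    rw [CcAlgebra.mk_apply, map_smul, _root_.smul_apply, inner_smul_right, mul_assoc,
      Complex.conj_mul']
    push_cast
    rfl
  simp_rw [h2] at h1
  rw [integral_complex_ofReal, Complex.ofReal_eq_zero] at h1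
  refine h1.not_gt (Continuous.integral_pos_of_hasCompactSupport_nonneg_nonzero (x := 1)
    (by fun_prop) ψ_comp.mul_right (fun s => mul_nonneg (ψ_nonneg s) (sq_nonneg _)) ?_)
  refine mul_ne_zero ψ_one (pow_ne_zero _ (norm_ne_zero_iff.2 ?_))
  simpa only [h, p.1.2.UL_one] using hne

lemma invariant_iff (p : R) (hp : IsNondegenerate p.1.2.π) (K : Submodule ℂ p.1.1)
    (hK : IsClosed (K : Set p.1.1)) :
    ((∀ a, ∀ x ∈ K, p.1.2.π a x ∈ K) ∧ ∀ s, ∀ x ∈ K, p.1.2.UL s x ∈ K) ↔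
      ∀ c : CrossedProduct α μ R, ∀ x ∈ K, integratedForm p c x ∈ K := by
  constructor
  · rintro ⟨hπ, hU⟩ c x hx
    refine denseRange_q.induction_on (p := fun c => integratedForm p c x ∈ K) c
      (hK.preimage ((continuous_repL_apply (integratedForm p)).clm_apply continuous_const))
      fun f => ?_
    rw [integratedForm_q, intForm_apply_UL]
    exact integral_mem_of_isClosed (integrable_intForm _ _ _) hK fun s =>
      hπ _ _ (hU _ _ hx)
  · intro h
    obtain ⟨l, hl, hl1, hlb⟩ := exists_contractive_approxUnit (CrossedProduct α μ R)
    have key : ∀ S : p.1.1 →L[ℂ] p.1.1,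
        (∀ c : CrossedProduct α μ R,
          ∃ d : CrossedProduct α μ R, S * integratedForm p c = integratedForm p d) →
        ∀ x ∈ K, S x ∈ K := by
      intro S hS x hx
      refine hK.mem_of_tendsto ((S.continuous.tendsto x).comp (tendsto_apply_approxUnit
        (isNondegenerate_integratedForm p hp) hl1 hlb x)) (Eventually.of_forall fun c => ?_)
      obtain ⟨d, hd⟩ := hS c
      have : S (integratedForm p c x) = integratedForm p d x := DFunLike.congr_fun hd x
      rw [Function.comp_apply, this]
      exact h d x hx
    exact ⟨fun a => key _ fun c => ⟨_, (integratedForm_leftA p a c).symm⟩,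
      fun s => key _ fun c => ⟨_, (integratedForm_leftG p s c).symm⟩⟩

lemma intertwines_iff (p p' : R) (hp : IsNondegenerate p.1.2.π) (Φ : p.1.1 →L[ℂ] p'.1.1) :
    ((∀ a, (p'.1.2.π a).comp Φ = Φ.comp (p.1.2.π a)) ∧
        ∀ s, (p'.1.2.UL s).comp Φ = Φ.comp (p.1.2.UL s)) ↔
      ∀ c : CrossedProduct α μ R,
        (integratedForm p' c).comp Φ = Φ.comp (integratedForm p c) := by
  constructor
  · rintro ⟨hπ, hU⟩ c
    refine denseRange_q.induction_on
      (p := fun c => (integratedForm p' c).comp Φ = Φ.comp (integratedForm p c)) c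
      (isClosed_eq ((continuous_repL_apply (integratedForm p')).clm_comp continuous_const)
        (continuous_const.clm_comp (continuous_repL_apply (integratedForm p)))) fun f => ?_
    ext x
    simp only [ContinuousLinearMap.comp_apply, integratedForm_q, intForm_apply_UL]
    rw [← ContinuousLinearMap.integral_comp_comm _ (integrable_intForm _ _ _)]
    congr 1
    ext s
    have h1 := DFunLike.congr_fun (hπ (f s)) (p.1.2.UL s x)
    have h2 := DFunLike.congr_fun (hU s) x
    simp only [ContinuousLinearMap.comp_apply] at h1 h2
    rw [h2, h1]
  · intro h
    have h' : ∀ c : CrossedProduct α μ R, ∀ x,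
        integratedForm p' c (Φ x) = Φ (integratedForm p c x) :=
      fun c x => DFunLike.congr_fun (h c) x
    have hp := isNondegenerate_integratedForm (μ := μ) p hp
    refine ⟨fun a => hp.ext fun c x => ?_, fun s => hp.ext fun c x => ?_⟩
    · simp only [ContinuousLinearMap.comp_apply, ← mul_apply_eq_comp, ← h',
        ← integratedForm_leftA]
    · simp only [ContinuousLinearMap.comp_apply, ← mul_apply_eq_comp, ← h',
        ← integratedForm_leftG]

lemma covRep_eq_of_integratedForm_eq {H : HilbertSp.{v}} {ρ ρ' : CovRep α H}
    (hρ : (⟨H, ρ⟩ : Σ H : HilbertSp.{v}, CovRep α H) ∈ R)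
    (hρ' : (⟨H, ρ'⟩ : Σ H : HilbertSp.{v}, CovRep α H) ∈ R) (hn : IsNondegenerate ρ.π)
    (h : integratedForm (μ := μ) (⟨_, hρ⟩ : R) = integratedForm (⟨_, hρ'⟩ : R)) : ρ = ρ' := by
  have h1 := (intertwines_iff (μ := μ) (⟨_, hρ⟩ : R) (⟨_, hρ'⟩ : R) hn
    (ContinuousLinearMap.id ℂ H)).2 fun c => by rw [h]; rfl
  exact CovRep.ext (fun a => (h1.1 a).symm) fun s => (h1.2 s).symm

end Integration

section ApproximateIdentity

variable {l : Filter A} {M : ℝ}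

lemma eventually_norm_mul_sub_le (hM : 0 ≤ M) (hl : ∀ᶠ u in l, ‖u‖ ≤ M)
    (hlA : ∀ a : A, Tendsto (fun u => u * a) l (𝓝 a)) {K : Set A} (hK : IsCompact K) {δ : ℝ}
    (hδ : 0 < δ) : ∀ᶠ u in l, ∀ a ∈ K, ‖u * a - a‖ ≤ δ := by
  obtain ⟨t, -, ht, hKt⟩ := hK.finite_cover_balls (show 0 < δ / (M + 2) by positivity)
  have h1 : ∀ᶠ u in l, ∀ b ∈ t, ‖u * b - b‖ < δ / (M + 2) :=
    (eventually_all_finite ht).2 fun b _ => by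
      simpa only [dist_eq_norm] using Metric.tendsto_nhds.1 (hlA b) _ (by positivity)
  filter_upwards [hl, h1] with u hu hut a ha
  obtain ⟨b, hb, hab⟩ := Set.mem_iUnion₂.1 (hKt ha)
  rw [Metric.mem_ball, dist_eq_norm] at hab
  have e : u * a - a = u * (a - b) + (u * b - b) - (a - b) := by rw [mul_sub]; abel
  calc ‖u * a - a‖ ≤ ‖u‖ * ‖a - b‖ + ‖u * b - b‖ + ‖a - b‖ := by
        rw [e]
        exact (norm_sub_le _ _).trans (add_le_add_left ((norm_add_le _ _).trans
          (add_le_add_left (norm_mul_le _ _) _)) _)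
    _ ≤ M * (δ / (M + 2)) + δ / (M + 2) + δ / (M + 2) := by
        gcongr
        exact (hut b hb).le
    _ = δ := by field_simp; ring

lemma tendsto_leftA_q (hM : 0 ≤ M) (hl : ∀ᶠ u in l, ‖u‖ ≤ M)
    (hlA : ∀ a : A, Tendsto (fun u => u * a) l (𝓝 a)) (f : CcAlgebra α μ R) :
    Tendsto (fun u => leftA α μ R u (q f)) l (𝓝 (q f)) := by
  rw [Metric.tendsto_nhds]
  intro ε hε
  have hfin : μ (tsupport f) < ⊤ := f.hasCompactSupport.isCompact.measure_lt_top
  filter_upwards [eventually_norm_mul_sub_le hM hl hlA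
    (f.hasCompactSupport.isCompact.image f.continuous)
    (show 0 < ε / (μ.real (tsupport f) + 1) by positivity)] with u hu
  have h1 : ∫ s, ‖(leftMul u f - f) s‖ ∂μ = ∫ s in tsupport f, ‖u * f s - f s‖ ∂μ := by
    refine (setIntegral_eq_integral_of_forall_compl_eq_zero fun s hs => ?_).symm
    change ‖u * f s - f s‖ = 0
    rw [image_eq_zero_of_notMem_tsupport hs, mul_zero, sub_zero, norm_zero]
  have h2 : ‖∫ s in tsupport f, ‖u * f s - f s‖ ∂μ‖ ≤
      ε / (μ.real (tsupport f) + 1) * μ.real (tsupport f) :=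
    norm_setIntegral_le_of_norm_le_const hfin fun s hs => by
      rw [norm_norm]
      exact hu _ ⟨s, hs, rfl⟩
  rw [dist_eq_norm, leftA_q, ← map_sub, norm_q]
  calc sigma (leftMul u f - f) ≤ ε / (μ.real (tsupport f) + 1) * μ.real (tsupport f) :=
        (sigma_le_integral_norm _).trans (h1.le.trans ((le_abs_self _).trans h2))
    _ < ε / (μ.real (tsupport f) + 1) * (μ.real (tsupport f) + 1) := by
        gcongr
        linarith
    _ = ε := by field_simp

end ApproximateIdentity

section Disintegration

variable {H : Type v} [NormedAddCommGroup H] [InnerProductSpace ℂ H] [CompleteSpace H]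
  {T : CrossedProduct α μ R →⋆ₙₐ[ℂ] (H →L[ℂ] H)} (hT : IsNondegenerate T)

/-- The operator `π(a)` determined by a non-degenerate representation of the crossed product. -/
def repA (a : A) : H →L[ℂ] H := multOp hT (leftA α μ R a) (leftA_mul a)

/-- The operator `U_s` determined by a non-degenerate representation of the crossed product. -/
def repG (s : G) : H →L[ℂ] H := multOp hT (leftG α μ R s) (leftG_mul s)

lemma repA_apply (a : A) (c : CrossedProduct α μ R) (x : H) :
    repA hT a (T c x) = T (leftA α μ R a c) x := multOp_apply _ _ _ _ _

lemma repG_apply (s : G) (c : CrossedProduct α μ R) (x : H) :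
    repG hT s (T c x) = T (leftG α μ R s c) x := multOp_apply _ _ _ _ _

lemma norm_repA_le (a : A) : ‖repA hT a‖ ≤ ‖a‖ := (norm_multOp_le _ _ _).trans (norm_leftA_le a)

lemma norm_repG_le (s : G) : ‖repG hT s‖ ≤ 1 := (norm_multOp_le _ _ _).trans (norm_leftG_le s)

lemma repG_mul (s t : G) : repG hT (s * t) = repG hT s * repG hT t :=
  hT.ext fun c x => by
    rw [mul_apply_eq_comp, repG_apply, repG_apply, repG_apply, leftG_mul_left]

lemma repG_one : repG hT 1 = 1 :=
  hT.ext fun c x => by rw [repG_apply, leftG_one, one_apply_eq_self]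

lemma star_repG (s : G) : star (repG hT s) = repG hT s⁻¹ :=
  star_multOp hT _ _ _ _ (star_leftG_mul s)

lemma continuous_repG (x : H) : Continuous fun s => repG hT s x := by
  rw [continuous_iff_continuousAt]
  intro r
  obtain ⟨S, -, hS⟩ := exists_strong_limit (l := 𝓝 r) (repG hT) zero_le_one
    (Eventually.of_forall (norm_repG_le hT)) hT (by
      rintro _ ⟨c, x, rfl⟩
      simp_rw [repG_apply]
      exact ⟨_, (((continuous_repL_apply T).comp (continuous_leftG c)).clm_apply
        continuous_const).tendsto r⟩)
  have : S x = repG hT r x :=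
    tendsto_nhds_unique ((hS x).mono_left (pure_le_nhds r))
      (tendsto_pure_nhds (fun s => repG hT s x) r)
  simpa only [ContinuousAt, this] using hS x

/-- The covariant representation determined by a non-degenerate representation of the crossed
product. -/
def covRepOf : CovRep α H where
  π :=
    { toFun := repA hT
      map_smul' := fun z a => hT.ext fun c x => by
        simp only [repA_apply, map_smul, _root_.smul_apply, MonoidHom.id_apply]
      map_zero' := hT.ext fun c x => by
        simp only [repA_apply, map_zero, _root_.zero_apply]
      map_add' := fun a b => hT.ext fun c x => by
        simp only [repA_apply, map_add, _root_.add_apply]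
      map_mul' := fun a b => hT.ext fun c x => by
        simp only [repA_apply, mul_apply_eq_comp, leftA_mul_left]
      map_star' := fun a => (star_multOp hT _ _ _ _ (star_leftA_mul a)).symm }
  U :=
    { toFun := fun s => ⟨repG hT s, by
        rw [Unitary.mem_iff, star_repG, ← repG_mul, ← repG_mul, inv_mul_cancel, mul_inv_cancel,
          repG_one]
        exact ⟨rfl, rfl⟩⟩
      map_one' := Subtype.ext (repG_one hT)
      map_mul' := fun s t => Subtype.ext (repG_mul hT s t) }
  contractive := norm_repA_le hT
  continuous_orbit := continuous_repG hT
  covariant s a := hT.ext fun c x => by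
    change repA hT (α.act s a) (T c x) = repG hT s (repA hT a (repG hT s⁻¹ (T c x)))
    rw [repG_apply, repA_apply, repA_apply, repG_apply, leftA_act]

lemma intForm_covRepOf (f : CcAlgebra α μ R) : intForm (covRepOf hT) f = T (q f) :=
  hT.ext fun c x => by
    have h := ((repL T).flip x).integral_comp_comm (integrable_leftA_leftG f c)
    simp only [ContinuousLinearMap.flip_apply, repL_apply] at h
    rw [← mul_apply_eq_comp (T (q f)), ← map_mul T, q_mul, ← h, intForm_apply_UL]
    congr 1
    ext s
    change repA hT (f s) (repG hT s (T c x)) = _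
    rw [repG_apply, repA_apply]

lemma isNondegenerate_covRepOf {l : Filter A} [l.NeBot] {M : ℝ} (hM : 0 ≤ M)
    (hl : ∀ᶠ u in l, ‖u‖ ≤ M) (hlA : ∀ a : A, Tendsto (fun u => u * a) l (𝓝 a)) :
    IsNondegenerate (covRepOf hT).π := by
  have hT' := hT
  rw [isNondegenerate_iff_orthogonal] at hT' ⊢
  refine fun y hy => hT' y fun c x => ?_
  have hcont : Continuous fun c => inner ℂ y (T c x) :=
    continuous_const.inner ((continuous_repL_apply T).clm_apply continuous_const)
  refine denseRange_q.induction_on (p := fun c => inner ℂ y (T c x) = 0) c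
    (isClosed_eq hcont continuous_const) fun f => ?_
  refine tendsto_nhds_unique ((hcont.tendsto _).comp (tendsto_leftA_q hM hl hlA f))
    (tendsto_const_nhds.congr fun u => ?_)
  rw [Function.comp_apply, ← repA_apply hT]
  exact Eq.symm (show inner ℂ y (repA hT u (T (q f) x)) = 0 from hy u (T (q f) x))

end Disintegration

lemma integratedForm_eq (p : R) (T : CrossedProduct α μ R →⋆ₙₐ[ℂ] (p.1.1 →L[ℂ] p.1.1))
    (h : ∀ f, intForm p.1.2 f = T (q f)) : integratedForm p = T :=
  DFunLike.ext' <| denseRange_q.equalizer (continuous_repL_apply _) (continuous_repL_apply _) <|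
    funext fun f => (integratedForm_q p f).trans (h f)

end CrossedProduct

end CrossedProduct

end BanachCrossed

end

theorem theoremt {A : Type u} {G : Type w}
    -- `A` is a complex Banach algebra, possibly without unit, with a bounded involution
    [NonUnitalNormedRing A] [NormedSpace ℂ A] [IsScalarTower ℂ A A] [SMulCommClass ℂ A A]
    [CompleteSpace A] [StarRing A] [StarModule ℂ A] [ContinuousStar A]
    -- `G` is a locally compact Hausdorff group with left Haar measure `μ`
    [Group G] [TopologicalSpace G] [IsTopologicalGroup G] [LocallyCompactSpace G] [T2Space G]
    [MeasurableSpace G] [BorelSpace G] (μ : Measure G) [μ.IsHaarMeasure]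
    (α : InvolutiveSystem A G)
    (hA : ∀ ε : ℝ, 0 < ε → HasBoundedLeftApproxIdentity A (1 + ε))
    (𝓗 : Set HilbertSp.{v})
    (hR : (nondegCovReps α 𝓗).Nonempty) :
    -- the crossed product is a C*-algebra
    (CompleteSpace (CrossedProduct α μ (nondegCovReps α 𝓗)) ∧
      CStarRing (CrossedProduct α μ (nondegCovReps α 𝓗))) ∧
    -- integration is injective, with range the non-degenerate involutive representations
    (Function.Injective (fun p : nondegCovReps α 𝓗 =>
        (⟨p.1.1, CrossedProduct.integratedForm p⟩ : Σ H : HilbertSp.{v},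
          (CrossedProduct α μ (nondegCovReps α 𝓗) →⋆ₙₐ[ℂ] (H →L[ℂ] H)))) ∧
      Set.range (fun p : nondegCovReps α 𝓗 =>
        (⟨p.1.1, CrossedProduct.integratedForm p⟩ : Σ H : HilbertSp.{v},
          (CrossedProduct α μ (nondegCovReps α 𝓗) →⋆ₙₐ[ℂ] (H →L[ℂ] H)))) =
        nondegStarReps (CrossedProduct α μ (nondegCovReps α 𝓗)) 𝓗) ∧
    -- it preserves the closed invariant subspaces
    (∀ (p : nondegCovReps α 𝓗) (K : Submodule ℂ p.1.1), IsClosed (K : Set p.1.1) →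
      (((∀ a, ∀ x ∈ K, p.1.2.π a x ∈ K) ∧
          ∀ s, ∀ x ∈ K, (p.1.2.U s : p.1.1 →L[ℂ] p.1.1) x ∈ K) ↔
        ∀ c : CrossedProduct α μ (nondegCovReps α 𝓗), ∀ x ∈ K,
          CrossedProduct.integratedForm p c x ∈ K)) ∧
    -- it preserves the bounded intertwining operators
    (∀ (p p' : nondegCovReps α 𝓗) (Φ : p.1.1 →L[ℂ] p'.1.1),
      ((∀ a, (p'.1.2.π a).comp Φ = Φ.comp (p.1.2.π a)) ∧
          ∀ s, (p'.1.2.U s : p'.1.1 →L[ℂ] p'.1.1).comp Φ =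
            Φ.comp (p.1.2.U s : p.1.1 →L[ℂ] p.1.1)) ↔
        ∀ c : CrossedProduct α μ (nondegCovReps α 𝓗),
          (CrossedProduct.integratedForm p' c).comp Φ =
            Φ.comp (CrossedProduct.integratedForm p c)) := by
  refine ⟨⟨inferInstance, inferInstance⟩, ⟨?_, ?_⟩, fun p K hK => ?_, fun p p' Φ => ?_⟩
  · rintro ⟨⟨H, ρ⟩, hρ⟩ ⟨⟨H', ρ'⟩, hρ'⟩ h
    obtain ⟨h1, h2⟩ := Sigma.mk.inj_iff.1 h
    dsimp only at h1
    subst h1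
    obtain rfl : ρ = ρ' :=
      CrossedProduct.covRep_eq_of_integratedForm_eq hρ hρ' hρ.2 (eq_of_heq h2)
    rfl
  · refine Set.Subset.antisymm ?_ ?_
    · rintro _ ⟨p, rfl⟩
      exact ⟨p.2.1, CrossedProduct.isNondegenerate_integratedForm p p.2.2⟩
    · rintro ⟨H, T⟩ ⟨hH, hT⟩
      obtain ⟨l, hl, hl1, hlA⟩ := hA 1 one_pos
      have hn := CrossedProduct.isNondegenerate_covRepOf hT (by norm_num) hl1 hlA
      refine ⟨⟨⟨H, CrossedProduct.covRepOf hT⟩, hH, hn⟩, ?_⟩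
      exact congrArg (Sigma.mk H)
        (CrossedProduct.integratedForm_eq (⟨⟨H, CrossedProduct.covRepOf hT⟩, hH, hn⟩ :
          nondegCovReps α 𝓗) T (CrossedProduct.intForm_covRepOf hT))
  · exact CrossedProduct.invariant_iff p p.2.2 K hK
  · exact CrossedProduct.intertwines_iff p p' p.2.2 Φ
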